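/- Let $(M,g,J)$ be a Kähler manifold of real dimension $2n$, $n\ge 3$, with curvature $\bar R(X,Y,Z,U)=g(\bar R(X,Y)Z,U)$, $\bar R(X,Y)Z=\bar\nabla_X\bar\nabla_YZ-\bar\nabla_Y\bar\nabla_XZ-\bar\nabla_{[X,Y]}Z$, and let $D$ be a smooth $J$-invariant distribution on $M$ of codimension $2$. For a unit vector $\xi\in D^\perp$ (so $D^\perp=\mathrm{span}\{\xi,J\xi\}$) put $\eta=g(\xi,\cdot)$ and $\tilde\eta=g(J\xi,\cdot)$. Suppose that $(M,g,J,D)$ is a Kähler QCH-manifold (of quasi-constant holomorphic sectional curvatures): there is a function $f$ such that $\bar R(X,JX,JX,X)=f(q,\varphi)$ for every $q\in M$ and every unit $X\in T_qM$, where $\varphi\in[0,\pi/2]$ is the angle between $\mathrm{span}\{X,JX\}$ and $D^\perp(q)$. Then there are functions $a,b,c$ on $M$ with $$\bar R=a\pi+b\Phi+c\Psi,$$ where $$4\pi(X,Y,Z,U)=g(Y,Z)g(X,U)-g(X,Z)g(Y,U)+g(JY,Z)g(JX,U)-g(JX,Z)g(JY,U)-2g(JX,Y)g(JZ,U),$$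 $$\begin{aligned}8\Phi(X,Y,Z,U)={}&g(Y,Z)\{\eta(X)\eta(U)+\tilde\eta(X)\tilde\eta(U)\}-g(X,Z)\{\eta(Y)\eta(U)+\tilde\eta(Y)\tilde\eta(U)\}\\&+g(X,U)\{\eta(Y)\eta(Z)+\tilde\eta(Y)\tilde\eta(Z)\}-g(Y,U)\{\eta(X)\eta(Z)+\tilde\eta(X)\tilde\eta(Z)\}\\&+g(JY,Z)\{\eta(X)\tilde\eta(U)-\eta(U)\tilde\eta(X)\}-g(JX,Z)\{\eta(Y)\tilde\eta(U)-\eta(U)\tilde\eta(Y)\}\\&+g(JX,U)\{\eta(Y)\tilde\eta(Z)-\eta(Z)\tilde\eta(Y)\}-g(JY,U)\{\eta(X)\tilde\eta(Z)-\eta(Z)\tilde\eta(X)\}\\&-2g(JX,Y)\{\eta(Z)\tilde\eta(U)-\eta(U)\tilde\eta(Z)\}-2g(JZ,U)\{\eta(X)\tilde\eta(Y)-\eta(Y)\tilde\eta(X)\},\end{aligned}$$ $$\begin{aligned}\Psi(X,Y,Z,U)={}&\eta(Y)\eta(Z)\tilde\eta(X)\tilde\eta(U)-\eta(X)\eta(Z)\tilde\eta(Y)\tilde\eta(U)\\&+\eta(X)\eta(U)\tilde\eta(Y)\tilde\eta(Z)-\eta(Y)\eta(U)\tilde\eta(X)\tilde\eta(Z).\end{aligned}$$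 Let $a,b,c$ be any such functions, and let $N$ be an (immersed) Lagrangian submanifold of $M$ of real dimension $n$, that is, $J$ maps each tangent space of $N$ into the corresponding normal space; $N$ carries the induced metric. Let $R$ be the curvature tensor of $N$ (with the same conventions as $\bar R$), $h$ its second fundamental form, $K(u\wedge v)=R(u,v,v,u)$ for orthonormal $u,v$, and, for an orthonormal basis $e_1,\dots,e_n$ of $T_pN$, let $\tau(p)=\sum_{i<j}K(e_i\wedge e_j)$, $H(p)=\frac1n\sum_i h(e_i,e_i)$ and $\mathrm{Ric}(X)=\sum_i R(X,e_i,e_i,X)$ for a unit vector $X\in T_pN$ (so $\mathrm{Ric}(X)=\sum_{i\ge2}K(e_1\wedge e_i)$ if $e_1=X$). Let $\eta^\top,\tilde\eta^\top\in T_pN$ be the tangential parts of $\xi,J\xi$. Then for every $p\in N$ (with $a,b,c$ and a unit $\xi\in D^\perp$ taken at $p$) and every unit vector $X\in T_pN$, $$\begin{aligned}\mathrm{Ric}(X)\ge{}&-\frac{(n-2)(n-1)(n+1)}{8}a-\frac{n-2}{8}\{n-[\eta(X)^2+\tilde\eta(X)^2]\}b\\&-\{(n-1)[\|\eta^\top\|^2\|\tilde\eta^\top\|^2-g(\eta^\top,\tilde\eta^\top)^2]-\|\eta(X)\tilde\eta^\top-\tilde\eta(X)\eta^\top\|^2\}c\\&+(n-1)\tau-\frac{(3n-1)(n-2)n^2}{2(3n+5)}\|H\|^2.\end{aligned}$$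 Equality holds for every unit vector $X\in T_pN$ if and only if $p$ is a totally geodesic point, i.e. $h=0$ at $p$. -/

import Mathlib

open Module Bundle
open scoped Manifold ContDiff Topology

noncomputable section

namespace KahlerQCH

section Coordinates

variable {E : Type*} [NormedAddCommGroup E] [NormedSpace ℝ E]

/-- Christoffel symbols (as a vector-valued expression `Γ_y(u, v)`) of the Levi-Civita connection
of a metric `G` given on a coordinate domain: `Γ_y(u, v)` is the vector with
`G_y(Γ_y(u, v), w) = (∂_u G(v, w) + ∂_v G(u, w) - ∂_w G(u, v)) / 2` for all `w`. -/
def christoffel (G : E → E →L[ℝ] E →L[ℝ] ℝ) (y u v : E) : E :=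
  (G y).inverse
    ((1 / 2 : ℝ) • (fderiv ℝ G y u v + fderiv ℝ G y v u - ((fderiv ℝ G y).flip u).flip v))

/-- The (0,4) curvature tensor `R(u, v, w, z) = G(R(u, v) w, z)` of a metric in coordinates, with
`R(u, v) w = ∇_u ∇_v w - ∇_v ∇_u w - ∇_[u, v] w` (evaluated on constant vector fields). -/
def coordCurvature (G : E → E →L[ℝ] E →L[ℝ] ℝ) (y u v w z : E) : ℝ :=
  G y (fderiv ℝ (fun x => christoffel G x v w) y u - fderiv ℝ (fun x => christoffel G x u w) y v
    + christoffel G y u (christoffel G y v w) - christoffel G y v (christoffel G y u w)) z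

end Coordinates

section Riemannian

variable {E : Type*} [NormedAddCommGroup E] [NormedSpace ℝ E]
  {M : Type*} [TopologicalSpace M] [ChartedSpace E M]

/-- The coordinate expression, in the preferred chart around `p`, of a field of bilinear forms:
its pull-back under the inverse of the chart. -/
def metricInChart (g : ∀ x : M, TangentSpace 𝓘(ℝ, E) x →L[ℝ] TangentSpace 𝓘(ℝ, E) x →L[ℝ] ℝ)
    (p : M) (y : E) : E →L[ℝ] E →L[ℝ] ℝ :=
  let d : E →L[ℝ] E := mfderiv 𝓘(ℝ, E) 𝓘(ℝ, E) (extChartAt 𝓘(ℝ, E) p).symm y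
  let B : E →L[ℝ] E →L[ℝ] ℝ := g ((extChartAt 𝓘(ℝ, E) p).symm y)
  B.bilinearComp d d

/-- The coordinate expression of a field of endomorphisms in the preferred chart around `p`. -/
def endoInChart (J : ∀ x : M, TangentSpace 𝓘(ℝ, E) x →L[ℝ] TangentSpace 𝓘(ℝ, E) x)
    (p : M) (y : E) : E →L[ℝ] E :=
  let d : E →L[ℝ] E := mfderiv 𝓘(ℝ, E) 𝓘(ℝ, E) (extChartAt 𝓘(ℝ, E) p).symm y
  let A : E →L[ℝ] E := J ((extChartAt 𝓘(ℝ, E) p).symm y)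
  let d' : E →L[ℝ] E :=
    mfderiv 𝓘(ℝ, E) 𝓘(ℝ, E) (extChartAt 𝓘(ℝ, E) p) ((extChartAt 𝓘(ℝ, E) p).symm y)
  d' ∘L A ∘L d

/-- The Riemannian curvature tensor `R(X, Y, Z, U) = g(R(X, Y) Z, U)` at `p`, computed in the
preferred chart around `p`. (By Mathlib's convention `T_p M` is the model space `E`, a tangent
vector at `p` being identified with its coordinates in exactly this chart.) -/
def riemann (g : ∀ x : M, TangentSpace 𝓘(ℝ, E) x →L[ℝ] TangentSpace 𝓘(ℝ, E) x →L[ℝ] ℝ)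
    (p : M) (X Y Z U : TangentSpace 𝓘(ℝ, E) p) : ℝ :=
  coordCurvature (metricInChart g p) (extChartAt 𝓘(ℝ, E) p p) X Y Z U

/-- Orthonormal `n`-tuples of tangent vectors. -/
def IsOrthonormalFrame {n : ℕ}
    (g : ∀ x : M, TangentSpace 𝓘(ℝ, E) x →L[ℝ] TangentSpace 𝓘(ℝ, E) x →L[ℝ] ℝ)
    (p : M) (e : Fin n → TangentSpace 𝓘(ℝ, E) p) : Prop :=
  ∀ i j, g p (e i) (e j) = if i = j then 1 else 0

/-- Sectional curvature `K(u ∧ v) = R(u, v, v, u)` of the plane with orthonormal basis `u, v`. -/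
def sectionalCurvature (g : ∀ x : M, TangentSpace 𝓘(ℝ, E) x →L[ℝ] TangentSpace 𝓘(ℝ, E) x →L[ℝ] ℝ)
    (p : M) (u v : TangentSpace 𝓘(ℝ, E) p) : ℝ :=
  riemann g p u v v u

/-- Scalar curvature in the normalization `τ = ∑_{i < j} K(e_i ∧ e_j)`, for an orthonormal
basis `e` of `T_p M`. -/
def scalarCurvature {n : ℕ}
    (g : ∀ x : M, TangentSpace 𝓘(ℝ, E) x →L[ℝ] TangentSpace 𝓘(ℝ, E) x →L[ℝ] ℝ)
    (p : M) (e : Fin n → TangentSpace 𝓘(ℝ, E) p) : ℝ :=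
  ∑ i, ∑ j ∈ Finset.Ioi i, sectionalCurvature g p (e i) (e j)

/-- Ricci curvature of a unit vector `X`, namely `∑ i, R(X, e_i, e_i, X)` for an orthonormal
basis `e` of `T_p M`. If `e_1 = X` the first summand is zero and this is the sum of the
`K(e_1 ∧ e_i)` for `i = 2, …, n`. -/
def ricci {n : ℕ}
    (g : ∀ x : M, TangentSpace 𝓘(ℝ, E) x →L[ℝ] TangentSpace 𝓘(ℝ, E) x →L[ℝ] ℝ)
    (p : M) (e : Fin n → TangentSpace 𝓘(ℝ, E) p) (X : TangentSpace 𝓘(ℝ, E) p) : ℝ :=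
  ∑ i, riemann g p X (e i) (e i) X

end Riemannian

section Kahler

variable {E : Type*} [NormedAddCommGroup E] [NormedSpace ℝ E]
  {M : Type*} [TopologicalSpace M] [ChartedSpace E M] [IsManifold 𝓘(ℝ, E) ∞ M]

/-- `(M, g, J)` is a Kähler manifold: `J` is a field of endomorphisms, smooth in every preferred
chart, with `J² = -1`, the metric is Hermitian, and `J` is parallel for the Levi-Civita connection, that is
`(∇_u J) v = ∂_u (J v) + Γ(u, J v) - J Γ(u, v) = 0` in every preferred chart. -/
structure IsKahler
    (g : ContMDiffRiemannianMetric 𝓘(ℝ, E) ∞ E (fun x : M => TangentSpace 𝓘(ℝ, E) x))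
    (J : ∀ x : M, TangentSpace 𝓘(ℝ, E) x →L[ℝ] TangentSpace 𝓘(ℝ, E) x) : Prop where
  smooth : ∀ p : M, ContDiffOn ℝ ∞ (endoInChart J p) (extChartAt 𝓘(ℝ, E) p).target
  sq : ∀ (x : M) (v : TangentSpace 𝓘(ℝ, E) x), J x (J x v) = -v
  hermitian : ∀ (x : M) (v w : TangentSpace 𝓘(ℝ, E) x),
    g.inner x (J x v) (J x w) = g.inner x v w
  parallel : ∀ (p : M), ∀ y ∈ (extChartAt 𝓘(ℝ, E) p).target, ∀ u v : E,
    fderiv ℝ (fun x => endoInChart J p x v) y u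
      + christoffel (metricInChart g.inner p) y u (endoInChart J p y v)
      - endoInChart J p y (christoffel (metricInChart g.inner p) y u v) = 0

/-- `ξ` is a unit vector in the orthogonal complement of `D` at `x`. -/
def IsUnitNormal
    (g : ContMDiffRiemannianMetric 𝓘(ℝ, E) ∞ E (fun x : M => TangentSpace 𝓘(ℝ, E) x))
    (D : ∀ x : M, Submodule ℝ (TangentSpace 𝓘(ℝ, E) x))
    (x : M) (ξ : TangentSpace 𝓘(ℝ, E) x) : Prop :=
  g.inner x ξ ξ = 1 ∧ ∀ v ∈ D x, g.inner x ξ v = 0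

/-- `D` is a smooth `J`-invariant distribution of codimension two. As `D` is `J`-invariant, its
orthogonal complement is spanned by `ξ, Jξ` for any unit vector `ξ` in it, and smoothness means
that `ξ` can be chosen locally as a smooth vector field. -/
structure IsInvariantDistribution
    (g : ContMDiffRiemannianMetric 𝓘(ℝ, E) ∞ E (fun x : M => TangentSpace 𝓘(ℝ, E) x))
    (J : ∀ x : M, TangentSpace 𝓘(ℝ, E) x →L[ℝ] TangentSpace 𝓘(ℝ, E) x)
    (D : ∀ x : M, Submodule ℝ (TangentSpace 𝓘(ℝ, E) x)) : Prop where
  invariant : ∀ x : M, ∀ v ∈ D x, J x v ∈ D x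
  codim : ∀ x : M, finrank ℝ (D x) + 2 = finrank ℝ E
  smooth : ∀ p : M, ∃ s : Set M, IsOpen s ∧ p ∈ s ∧ ∃ ξ : ∀ x : M, TangentSpace 𝓘(ℝ, E) x,
    ContMDiffOn 𝓘(ℝ, E) 𝓘(ℝ, E).tangent ∞
      (fun x => (⟨x, ξ x⟩ : TangentBundle 𝓘(ℝ, E) M)) s ∧
    ∀ x ∈ s, IsUnitNormal g D x (ξ x)

/-- The angle between the holomorphic sections `span {X, JX}` and `span {ξ, Jξ}`, for unit vectors
`X` and `ξ`: its cosine is the norm of the orthogonal projection of `X` to `span {ξ, Jξ}`. The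
projection commutes with `J`, so all unit vectors of `span {X, JX}` give the same value. -/
def sectionAngle
    (g : ContMDiffRiemannianMetric 𝓘(ℝ, E) ∞ E (fun x : M => TangentSpace 𝓘(ℝ, E) x))
    (J : ∀ x : M, TangentSpace 𝓘(ℝ, E) x →L[ℝ] TangentSpace 𝓘(ℝ, E) x)
    (x : M) (ξ X : TangentSpace 𝓘(ℝ, E) x) : ℝ :=
  Real.arccos (√(g.inner x ξ X ^ 2 + g.inner x (J x ξ) X ^ 2))

/-- Quasi-constant holomorphic sectional curvature: the sectional curvature of `span {X, JX}`
depends only on the point and on the angle between this section and the orthogonal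
complement of `D`. -/
def IsQCH
    (g : ContMDiffRiemannianMetric 𝓘(ℝ, E) ∞ E (fun x : M => TangentSpace 𝓘(ℝ, E) x))
    (J : ∀ x : M, TangentSpace 𝓘(ℝ, E) x →L[ℝ] TangentSpace 𝓘(ℝ, E) x)
    (D : ∀ x : M, Submodule ℝ (TangentSpace 𝓘(ℝ, E) x)) : Prop :=
  ∃ f : M → ℝ → ℝ, ∀ (x : M) (ξ X : TangentSpace 𝓘(ℝ, E) x),
    IsUnitNormal g D x ξ → g.inner x X X = 1 →
      riemann g.inner x X (J x X) (J x X) X = f x (sectionAngle g J x ξ X)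

/-- The tensor `π`. -/
def tensorPi
    (g : ContMDiffRiemannianMetric 𝓘(ℝ, E) ∞ E (fun x : M => TangentSpace 𝓘(ℝ, E) x))
    (J : ∀ x : M, TangentSpace 𝓘(ℝ, E) x →L[ℝ] TangentSpace 𝓘(ℝ, E) x)
    (x : M) (X Y Z U : TangentSpace 𝓘(ℝ, E) x) : ℝ :=
  let G := fun v w => g.inner x v w
  let j := fun v => J x v
  (G Y Z * G X U - G X Z * G Y U + G (j Y) Z * G (j X) U - G (j X) Z * G (j Y) U
    - 2 * G (j X) Y * G (j Z) U) / 4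

/-- The tensor `Φ`, with `η = g(ξ, ·)` and `η' = g(Jξ, ·)`. -/
def tensorPhi
    (g : ContMDiffRiemannianMetric 𝓘(ℝ, E) ∞ E (fun x : M => TangentSpace 𝓘(ℝ, E) x))
    (J : ∀ x : M, TangentSpace 𝓘(ℝ, E) x →L[ℝ] TangentSpace 𝓘(ℝ, E) x)
    (x : M) (ξ X Y Z U : TangentSpace 𝓘(ℝ, E) x) : ℝ :=
  let G := fun v w => g.inner x v w
  let j := fun v => J x v
  let η := fun v => g.inner x ξ v
  let η' := fun v => g.inner x (J x ξ) v
  (G Y Z * (η X * η U + η' X * η' U) - G X Z * (η Y * η U + η' Y * η' U)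
    + G X U * (η Y * η Z + η' Y * η' Z) - G Y U * (η X * η Z + η' X * η' Z)
    + G (j Y) Z * (η X * η' U - η U * η' X) - G (j X) Z * (η Y * η' U - η U * η' Y)
    + G (j X) U * (η Y * η' Z - η Z * η' Y) - G (j Y) U * (η X * η' Z - η Z * η' X)
    - 2 * G (j X) Y * (η Z * η' U - η U * η' Z)
    - 2 * G (j Z) U * (η X * η' Y - η Y * η' X)) / 8

/-- The tensor `Ψ`, with `η = g(ξ, ·)` and `η' = g(Jξ, ·)`. -/
def tensorPsi
    (g : ContMDiffRiemannianMetric 𝓘(ℝ, E) ∞ E (fun x : M => TangentSpace 𝓘(ℝ, E) x))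
    (J : ∀ x : M, TangentSpace 𝓘(ℝ, E) x →L[ℝ] TangentSpace 𝓘(ℝ, E) x)
    (x : M) (ξ X Y Z U : TangentSpace 𝓘(ℝ, E) x) : ℝ :=
  let η := fun v => g.inner x ξ v
  let η' := fun v => g.inner x (J x ξ) v
  η Y * η Z * η' X * η' U - η X * η Z * η' Y * η' U
    + η X * η U * η' Y * η' Z - η Y * η U * η' X * η' Z

/-- `a, b, c` are the coefficient functions of the curvature: `R = a π + b Φ + c Ψ`.
The tensors `Φ, Ψ` do not depend on the choice of the unit vector `ξ` in the plane
orthogonal to `D`. -/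
def IsCurvatureCoefficients
    (g : ContMDiffRiemannianMetric 𝓘(ℝ, E) ∞ E (fun x : M => TangentSpace 𝓘(ℝ, E) x))
    (J : ∀ x : M, TangentSpace 𝓘(ℝ, E) x →L[ℝ] TangentSpace 𝓘(ℝ, E) x)
    (D : ∀ x : M, Submodule ℝ (TangentSpace 𝓘(ℝ, E) x)) (a b c : M → ℝ) : Prop :=
  ∀ (x : M) (ξ : TangentSpace 𝓘(ℝ, E) x), IsUnitNormal g D x ξ →
    ∀ X Y Z U : TangentSpace 𝓘(ℝ, E) x,
      riemann g.inner x X Y Z U =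
        a x * tensorPi g J x X Y Z U + b x * tensorPhi g J x ξ X Y Z U
          + c x * tensorPsi g J x ξ X Y Z U

end Kahler

section Submanifold

variable {E : Type*} [NormedAddCommGroup E] [NormedSpace ℝ E]
  {F : Type*} [NormedAddCommGroup F] [NormedSpace ℝ F]
  {M : Type*} [TopologicalSpace M] [ChartedSpace E M] [IsManifold 𝓘(ℝ, E) ∞ M]
  {N : Type*} [TopologicalSpace N] [ChartedSpace F N]

/-- `ι : N → M` is a Lagrangian immersion: a smooth immersion, `dim M = 2 dim N`, such that
`J` maps each tangent space of `N` into (hence onto) the normal space. -/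
structure IsLagrangianImmersion
    (g : ContMDiffRiemannianMetric 𝓘(ℝ, E) ∞ E (fun x : M => TangentSpace 𝓘(ℝ, E) x))
    (J : ∀ x : M, TangentSpace 𝓘(ℝ, E) x →L[ℝ] TangentSpace 𝓘(ℝ, E) x) (ι : N → M) : Prop where
  contMDiff : ContMDiff 𝓘(ℝ, F) 𝓘(ℝ, E) ∞ ι
  injective_mfderiv : ∀ p : N, Function.Injective (mfderiv 𝓘(ℝ, F) 𝓘(ℝ, E) ι p)
  finrank_eq : finrank ℝ E = 2 * finrank ℝ F
  lagrangian : ∀ (p : N) (u v : TangentSpace 𝓘(ℝ, F) p),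
    g.inner (ι p) (J (ι p) (mfderiv 𝓘(ℝ, F) 𝓘(ℝ, E) ι p u)) (mfderiv 𝓘(ℝ, F) 𝓘(ℝ, E) ι p v) = 0

/-- The metric induced on `N` by `ι : N → M`. -/
def inducedMetric
    (g : ContMDiffRiemannianMetric 𝓘(ℝ, E) ∞ E (fun x : M => TangentSpace 𝓘(ℝ, E) x)) (ι : N → M)
    (p : N) : TangentSpace 𝓘(ℝ, F) p →L[ℝ] TangentSpace 𝓘(ℝ, F) p →L[ℝ] ℝ :=
  let d : F →L[ℝ] E := mfderiv 𝓘(ℝ, F) 𝓘(ℝ, E) ι p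
  let B : E →L[ℝ] E →L[ℝ] ℝ := g.inner (ι p)
  (B.bilinearComp d d : F →L[ℝ] F →L[ℝ] ℝ)

/-- The second fundamental form `h(u, v) = ∇̄_u dι(v) - dι(∇_u v)` of the immersion, with `∇̄` and
`∇` the Levi-Civita connections of `g` and of the induced metric, computed in the preferred
charts around `p` and `ι p` (evaluated on constant vector fields). -/
def secondFundamentalForm
    (g : ContMDiffRiemannianMetric 𝓘(ℝ, E) ∞ E (fun x : M => TangentSpace 𝓘(ℝ, E) x)) (ι : N → M)
    (p : N) (u v : TangentSpace 𝓘(ℝ, F) p) : TangentSpace 𝓘(ℝ, E) (ι p) :=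
  let f : F → E := writtenInExtChartAt 𝓘(ℝ, F) 𝓘(ℝ, E) p ι
  let y : F := extChartAt 𝓘(ℝ, F) p p
  (fderiv ℝ (fun x => fderiv ℝ f x v) y u
    + christoffel (metricInChart g.inner (ι p)) (f y) (fderiv ℝ f y u) (fderiv ℝ f y v)
    - fderiv ℝ f y (christoffel (metricInChart (inducedMetric g ι) p) y u v) : E)

/-- `p` is a totally geodesic point: the second fundamental form vanishes at `p`. -/
def IsTotallyGeodesicAt
    (g : ContMDiffRiemannianMetric 𝓘(ℝ, E) ∞ E (fun x : M => TangentSpace 𝓘(ℝ, E) x)) (ι : N → M)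
    (p : N) : Prop :=
  ∀ u v : TangentSpace 𝓘(ℝ, F) p, secondFundamentalForm g ι p u v = 0

/-- The mean curvature vector `H = (1/n) ∑ i, h(e_i, e_i)`, for an orthonormal basis `e`
of `T_p N`. -/
def meanCurvature {n : ℕ}
    (g : ContMDiffRiemannianMetric 𝓘(ℝ, E) ∞ E (fun x : M => TangentSpace 𝓘(ℝ, E) x)) (ι : N → M)
    (p : N) (e : Fin n → TangentSpace 𝓘(ℝ, F) p) : TangentSpace 𝓘(ℝ, E) (ι p) :=
  (1 / n : ℝ) • ∑ i, secondFundamentalForm g ι p (e i) (e i)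

/-- The tangential part (as a vector of `T_p N`) of `ζ ∈ T_{ι p} M`, for an orthonormal basis `e`
of `T_p N`. It represents the restriction of the form `g(ζ, ·)` to `T_p N`. -/
def tangentialPart {n : ℕ}
    (g : ContMDiffRiemannianMetric 𝓘(ℝ, E) ∞ E (fun x : M => TangentSpace 𝓘(ℝ, E) x)) (ι : N → M)
    (p : N) (e : Fin n → TangentSpace 𝓘(ℝ, F) p) (ζ : TangentSpace 𝓘(ℝ, E) (ι p)) :
    TangentSpace 𝓘(ℝ, F) p :=
  ∑ i, g.inner (ι p) ζ (mfderiv 𝓘(ℝ, F) 𝓘(ℝ, E) ι p (e i)) • e i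

/-- The right-hand side of the Ricci inequality, for the values `a, b, c` of the curvature
coefficients at `ι p`, a unit vector `ξ` normal to the distribution, an orthonormal basis `e`
of `T_p N` and a unit vector `X ∈ T_p N`. -/
def ricciLowerBound {n : ℕ}
    (g : ContMDiffRiemannianMetric 𝓘(ℝ, E) ∞ E (fun x : M => TangentSpace 𝓘(ℝ, E) x))
    (J : ∀ x : M, TangentSpace 𝓘(ℝ, E) x →L[ℝ] TangentSpace 𝓘(ℝ, E) x) (ι : N → M)
    (a b c : ℝ) (p : N) (ξ : TangentSpace 𝓘(ℝ, E) (ι p))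
    (e : Fin n → TangentSpace 𝓘(ℝ, F) p) (X : TangentSpace 𝓘(ℝ, F) p) : ℝ :=
  let γ := fun u v => inducedMetric g ι p u v
  let ηX : ℝ := g.inner (ι p) ξ (mfderiv 𝓘(ℝ, F) 𝓘(ℝ, E) ι p X)
  let ηX' : ℝ := g.inner (ι p) (J (ι p) ξ) (mfderiv 𝓘(ℝ, F) 𝓘(ℝ, E) ι p X)
  let T := tangentialPart g ι p e ξ
  let T' := tangentialPart g ι p e (J (ι p) ξ)
  let W := ηX • T' - ηX' • T
  let H := meanCurvature g ι p e
  let τ := scalarCurvature (inducedMetric g ι) p e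
  let A : ℝ := ((n : ℝ) - 2) * (n - 1) * (n + 1) / 8
  let B : ℝ := ((n : ℝ) - 2) / 8 * (n - (ηX ^ 2 + ηX' ^ 2))
  let C : ℝ := ((n : ℝ) - 1) * (γ T T * γ T' T' - γ T T' ^ 2) - γ W W
  let K : ℝ := (3 * (n : ℝ) - 1) * (n - 2) * (n : ℝ) ^ 2 / (2 * (3 * n + 5))
  A * (-a) - B * b - C * c + ((n : ℝ) - 1) * τ - K * g.inner (ι p) H H

end Submanifold

end KahlerQCH

end

/-!
# The Ricci inequality for Lagrangian submanifolds of Kähler QCH-manifolds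

*The ambient curvature.* The curvature tensor `T` of a Kähler metric has the symmetries collected in
`IsKahlerTensor`, and such a tensor is determined by the quartic form `T(X, JX, JX, X)`
(`IsKahlerTensor.eq_zero`). If on unit vectors this form depends only on the angle to
`span {ξ, Jξ}`, whose squared cosine is `t = η(X)² + η'(X)²`, then evaluation at
`√(1 - t) u ± √t ξ`, with `u` a unit vector of the distribution, shows that it is a polynomial
`a + b t + c t²` (`IsKahlerTensor.exists_coefficients`). On unit vectors `1`, `t`, `t²` are the
holomorphic sectional curvatures of `π`, `Φ`, `Ψ`, so `T = a π + b Φ + c Ψ`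
(`IsKahlerTensor.eq_model`).

*The submanifold.* Since `J` is parallel and the tangent spaces are totally real, the components
`c i j r = g(h(e_i, e_j), J e_r)` of the second fundamental form are totally symmetric. Insert the
formula for `T` into the Gauss equation and sum over an orthonormal frame with `X = e_k`. By
`‖ξ^⊤‖² + ‖(Jξ)^⊤‖² = 1`, the terms with `a, b, c` of `Ric(X)` and of the lower bound cancel, and
the difference of the two sides is a quadratic form in `c`, namely `ricciDefect c k`
(`IsLagrangianPoint.ricci_sub_lowerBound`).

*The quadratic form.* By total symmetry, the components with distinct indices enter `ricciDefect`
only through their squares, with positive weights, and the others can be written as `c i i r`, where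
different `r` do not interact (`ricciDefect_eq`). For fixed `r` this leaves a form in the trace and
the squares of `x i = c i i r`. The Cauchy–Schwarz inequality for the indices other than `k, r`
reduces it to a quadratic form in two or three variables: a positive definite one for `r = k`, a
semidefinite one for `r ≠ k`. If the defect vanishes in every direction `k`, the components with
distinct indices vanish, and the case `r = k` gives `c i i k = 0` for all `i` and `k`; hence `h = 0`
(`eq_zero_of_ricciDefect_eq_zero`).

The curvature, the second fundamental form and the connections are those of the preferred charts, so
the Bianchi identity, the skew-symmetry of the curvature, its commutation with a parallel `J` and
the Gauss equation are obtained by differentiating identities for metrics on open subsets of the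
model space. The Christoffel symbols are bundled as a bilinear map for this purpose.
-/

section

set_option maxSynthPendingDepth 3
set_option linter.unusedSectionVars false

noncomputable section

namespace KahlerQCH

/-! ### Curvature of a metric on a coordinate domain -/

section CoordinateGeometry

variable {E : Type*} [NormedAddCommGroup E] [NormedSpace ℝ E]

/-- `G` is a smooth Riemannian metric on the set `s` of a coordinate space. -/
structure IsMetricOn (G : E → E →L[ℝ] E →L[ℝ] ℝ) (s : Set E) : Prop where
  contDiffOn : ContDiffOn ℝ ∞ G s
  symm : ∀ y ∈ s, ∀ v w, G y v w = G y w v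
  pos : ∀ y ∈ s, ∀ v, v ≠ 0 → 0 < G y v v

/-- The Christoffel symbols of the first kind as a bundled trilinear map: if `T u v w` is the
derivative `∂_u G(v, w)`, then `koszul T u v w = (T u v w + T v u w - T w u v) / 2`. -/
def koszul (T : E →L[ℝ] E →L[ℝ] E →L[ℝ] ℝ) : E →L[ℝ] E →L[ℝ] E →L[ℝ] ℝ :=
  (1 / 2 : ℝ) • (T + T.flip -
    (ContinuousLinearMap.flipₗᵢ ℝ E E ℝ : (E →L[ℝ] E →L[ℝ] ℝ) →L[ℝ] E →L[ℝ] E →L[ℝ] ℝ) ∘L T.flip)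

/-- The Christoffel symbols as a bundled bilinear map, so that they can be differentiated with
respect to the base point. -/
def christoffelCLM (G : E → E →L[ℝ] E →L[ℝ] ℝ) (y : E) : E →L[ℝ] E →L[ℝ] E :=
  ContinuousLinearMap.compL ℝ E (E →L[ℝ] ℝ) E (G y).inverse ∘L koszul (fderiv ℝ G y)

lemma koszul_apply (T : E →L[ℝ] E →L[ℝ] E →L[ℝ] ℝ) (u v w : E) :
    koszul T u v w = (T u v w + T v u w - T w u v) / 2 := by
  simp [koszul]; ring

lemma christoffelCLM_apply (G : E → E →L[ℝ] E →L[ℝ] ℝ) (y u v : E) :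
    christoffelCLM G y u v = christoffel G y u v := by
  simp only [christoffelCLM, christoffel, ContinuousLinearMap.comp_apply,
    ContinuousLinearMap.compL_apply]
  congr 1

variable [FiniteDimensional ℝ E]

/-- A positive definite form identifies a finite-dimensional space with its dual, so the
`ContinuousLinearMap.inverse` in `christoffel` is a true inverse. -/
lemma isInvertible_of_pos {B : E →L[ℝ] E →L[ℝ] ℝ} (hB : ∀ v, v ≠ 0 → 0 < B v v) :
    B.IsInvertible := by
  have hinj : Function.Injective (B : E →ₗ[ℝ] E →L[ℝ] ℝ) := by
    rw [← LinearMap.ker_eq_bot, LinearMap.ker_eq_bot']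
    intro v hv
    by_contra h
    have := hB v h
    have h2 : B v = 0 := hv
    simp [h2] at this
  have hfin : finrank ℝ E = finrank ℝ (E →L[ℝ] ℝ) := by
    rw [← (LinearMap.toContinuousLinearMap (𝕜 := ℝ) (E := E) (F' := ℝ)).finrank_eq]
    exact (Subspace.dual_finrank_eq (K := ℝ) (V := E)).symm
  let e := LinearEquiv.ofInjectiveOfFinrankEq (B : E →ₗ[ℝ] E →L[ℝ] ℝ) hinj hfin
  exact ⟨e.toContinuousLinearEquiv, by ext; rfl⟩

variable {G : E → E →L[ℝ] E →L[ℝ] ℝ} {s : Set E}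

namespace IsMetricOn

lemma contDiffAt (h : IsMetricOn G s) (hs : IsOpen s) {y : E} (hy : y ∈ s) :
    ContDiffAt ℝ ∞ G y :=
  h.contDiffOn.contDiffAt (hs.mem_nhds hy)

lemma contDiffAt_christoffelCLM (h : IsMetricOn G s) (hs : IsOpen s) {y : E} (hy : y ∈ s) :
    ContDiffAt ℝ ∞ (christoffelCLM G) y := by
  have := FiniteDimensional.complete ℝ E
  have hG := h.contDiffAt hs hy
  have hD : ContDiffAt ℝ ∞ (fderiv ℝ G) y := hG.fderiv_right (by simp)
  have hinv : ContDiffAt ℝ ∞ (fun x => (G x).inverse) y :=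
    ((isInvertible_of_pos (h.pos y hy)).contDiffAt_map_inverse (n := ∞)).comp y hG
  have hflip : ContDiffAt ℝ ∞ (fun x => (fderiv ℝ G x).flip) y :=
    (ContinuousLinearMap.flipₗᵢ ℝ E E (E →L[ℝ] ℝ)).contDiff.contDiffAt.comp y hD
  have hk : ContDiffAt ℝ ∞ (fun x => koszul (fderiv ℝ G x)) y :=
    ((hD.add hflip).sub (contDiffAt_const.clm_comp hflip)).const_smul (1 / 2 : ℝ)
  exact ((ContinuousLinearMap.compL ℝ E (E →L[ℝ] ℝ) E).contDiff.contDiffAt.comp y hinv).clm_comp hk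

lemma fderiv_symm (h : IsMetricOn G s) (hs : IsOpen s) {y : E} (hy : y ∈ s) (u v w : E) :
    fderiv ℝ G y u v w = fderiv ℝ G y u w v := by
  have hd : HasFDerivAt G (fderiv ℝ G y) y :=
    ((h.contDiffAt hs hy).differentiableAt (by simp)).hasFDerivAt
  have h1 := (hd.clm_apply (hasFDerivAt_const v y)).clm_apply (hasFDerivAt_const w y)
  have h2 := (hd.clm_apply (hasFDerivAt_const w y)).clm_apply (hasFDerivAt_const v y)
  have heq : (fun x => G x v w) =ᶠ[𝓝 y] fun x => G x w v := by
    filter_upwards [hs.mem_nhds hy] with x hx using h.symm x hx v w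
  have := congrArg (fun L : E →L[ℝ] ℝ => L u) (h1.unique (h2.congr_of_eventuallyEq heq))
  simpa using this

lemma apply_christoffelCLM (h : IsMetricOn G s) {y : E} (hy : y ∈ s) (u v w : E) :
    G y (christoffelCLM G y u v) w
      = (fderiv ℝ G y u v w + fderiv ℝ G y v u w - fderiv ℝ G y w u v) / 2 := by
  rw [← koszul_apply]
  simp only [christoffelCLM, ContinuousLinearMap.comp_apply, ContinuousLinearMap.compL_apply,
    (isInvertible_of_pos (h.pos y hy)).self_apply_inverse]

lemma eq_of_apply_eq (h : IsMetricOn G s) {y : E} (hy : y ∈ s) {v v' : E}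
    (hv : ∀ w, G y v w = G y v' w) : v = v' := by
  by_contra hne
  have := h.pos y hy (v - v') (sub_ne_zero.mpr hne)
  rw [map_sub (G y), sub_apply, hv, sub_self] at this
  exact lt_irrefl _ this

lemma christoffelCLM_symm (h : IsMetricOn G s) (hs : IsOpen s) {y : E} (hy : y ∈ s) (u v : E) :
    christoffelCLM G y u v = christoffelCLM G y v u := by
  refine h.eq_of_apply_eq hy fun w => ?_
  rw [h.apply_christoffelCLM hy, h.apply_christoffelCLM hy, h.fderiv_symm hs hy w u v]
  ring

/-- The Levi-Civita connection is metric. -/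
lemma fderiv_eq (h : IsMetricOn G s) (hs : IsOpen s) {y : E} (hy : y ∈ s) (u v w : E) :
    fderiv ℝ G y u v w
      = G y (christoffelCLM G y u v) w + G y v (christoffelCLM G y u w) := by
  rw [h.symm y hy v, h.apply_christoffelCLM hy, h.apply_christoffelCLM hy,
    h.fderiv_symm hs hy u w v, h.fderiv_symm hs hy w u v, h.fderiv_symm hs hy v u w]
  ring

end IsMetricOn

/-- The curvature operator `R(u, v) w` of a connection with Christoffel symbols `Γ`. -/
def curvatureOperator (Γ : E → E →L[ℝ] E →L[ℝ] E) (y u v w : E) : E :=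
  fderiv ℝ Γ y u v w - fderiv ℝ Γ y v u w + Γ y u (Γ y v w) - Γ y v (Γ y u w)

lemma curvatureOperator_swap (Γ : E → E →L[ℝ] E →L[ℝ] E) (y u v w : E) :
    curvatureOperator Γ y u v w = - curvatureOperator Γ y v u w := by
  simp only [curvatureOperator]; abel

namespace IsMetricOn

lemma hasFDerivAt (h : IsMetricOn G s) (hs : IsOpen s) {y : E} (hy : y ∈ s) :
    HasFDerivAt G (fderiv ℝ G y) y :=
  ((h.contDiffAt hs hy).differentiableAt (by simp)).hasFDerivAt

lemma hasFDerivAt_christoffelCLM (h : IsMetricOn G s) (hs : IsOpen s) {y : E} (hy : y ∈ s) :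
    HasFDerivAt (christoffelCLM G) (fderiv ℝ (christoffelCLM G) y) y :=
  ((h.contDiffAt_christoffelCLM hs hy).differentiableAt (by simp)).hasFDerivAt

lemma coordCurvature_eq (h : IsMetricOn G s) (hs : IsOpen s) {y : E} (hy : y ∈ s) (u v w z : E) :
    coordCurvature G y u v w z = G y (curvatureOperator (christoffelCLM G) y u v w) z := by
  have key : ∀ a b : E, fderiv ℝ (fun x => christoffel G x a w) y b
      = fderiv ℝ (christoffelCLM G) y b a w := by
    intro a b
    have h1 := ((h.hasFDerivAt_christoffelCLM hs hy).clm_apply (hasFDerivAt_const a y)).clm_apply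
      (hasFDerivAt_const w y)
    simp only [christoffelCLM_apply] at h1
    rw [h1.fderiv]
    simp
  simp only [coordCurvature, curvatureOperator, key, christoffelCLM_apply]

lemma fderiv_christoffelCLM_symm (h : IsMetricOn G s) (hs : IsOpen s) {y : E} (hy : y ∈ s)
    (u v w : E) :
    fderiv ℝ (christoffelCLM G) y u v w = fderiv ℝ (christoffelCLM G) y u w v := by
  have hd := h.hasFDerivAt_christoffelCLM hs hy
  have h1 := (hd.clm_apply (hasFDerivAt_const v y)).clm_apply (hasFDerivAt_const w y)
  have h2 := (hd.clm_apply (hasFDerivAt_const w y)).clm_apply (hasFDerivAt_const v y)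
  have heq : (fun x => christoffelCLM G x v w) =ᶠ[𝓝 y] fun x => christoffelCLM G x w v := by
    filter_upwards [hs.mem_nhds hy] with x hx using h.christoffelCLM_symm hs hx v w
  have := congrArg (fun L : E →L[ℝ] E => L u) (h1.unique (h2.congr_of_eventuallyEq heq))
  simpa using this

/-- The first Bianchi identity. -/
lemma bianchi (h : IsMetricOn G s) (hs : IsOpen s) {y : E} (hy : y ∈ s) (u v w : E) :
    curvatureOperator (christoffelCLM G) y u v w + curvatureOperator (christoffelCLM G) y v w u
      + curvatureOperator (christoffelCLM G) y w u v = 0 := by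
  simp only [curvatureOperator]
  rw [h.fderiv_christoffelCLM_symm hs hy u v w, h.fderiv_christoffelCLM_symm hs hy v w u,
    h.fderiv_christoffelCLM_symm hs hy w u v, h.christoffelCLM_symm hs hy v w,
    h.christoffelCLM_symm hs hy u w, h.christoffelCLM_symm hs hy v u]
  abel

/-- The curvature operator is skew-symmetric: this follows from differentiating the identity
`∂_v G(w, z) = G(Γ(v, w), z) + G(w, Γ(v, z))` along `u` and the symmetry of second derivatives. -/
lemma curvatureOperator_skew (h : IsMetricOn G s) (hs : IsOpen s) {y : E} (hy : y ∈ s)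
    (u v w z : E) :
    G y (curvatureOperator (christoffelCLM G) y u v w) z
      = - G y (curvatureOperator (christoffelCLM G) y u v z) w := by
  set Γ := christoffelCLM G with hΓdef
  have hd := h.hasFDerivAt hs hy
  have hΓ := h.hasFDerivAt_christoffelCLM hs hy
  have hG := h.contDiffAt hs hy
  have hDD : HasFDerivAt (fderiv ℝ G) (fderiv ℝ (fderiv ℝ G) y) y :=
    ((hG.fderiv_right (m := ∞) (by simp)).differentiableAt (by simp)).hasFDerivAt
  have key : ∀ a b : E, fderiv ℝ (fderiv ℝ G) y a b w z
      = (G y (Γ y a (Γ y b w)) z + G y (Γ y b w) (Γ y a z)) + G y (fderiv ℝ Γ y a b w) z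
        + ((G y (Γ y a w) (Γ y b z) + G y w (Γ y a (Γ y b z))) + G y w (fderiv ℝ Γ y a b z)) := by
    intro a b
    have h1 := ((hDD.clm_apply (hasFDerivAt_const b y)).clm_apply
      (hasFDerivAt_const w y)).clm_apply (hasFDerivAt_const z y)
    have hb : ∀ c : E, HasFDerivAt (fun x => Γ x b c) _ y := fun c =>
      (hΓ.clm_apply (hasFDerivAt_const b y)).clm_apply (hasFDerivAt_const c y)
    have h2 := ((hd.clm_apply (hb w)).clm_apply (hasFDerivAt_const z y)).add
      ((hd.clm_apply (hasFDerivAt_const w y)).clm_apply (hb z))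
    have heq : (fun x => fderiv ℝ G x b w z) =ᶠ[𝓝 y]
        (fun x => G x (Γ x b w) z) + fun x => G x w (Γ x b z) := by
      filter_upwards [hs.mem_nhds hy] with x hx using h.fderiv_eq hs hx b w z
    have h3 := congrArg (fun L : E →L[ℝ] ℝ => L a) (h1.unique (h2.congr_of_eventuallyEq heq))
    simp at h3
    rw [h3, h.fderiv_eq hs hy, h.fderiv_eq hs hy]
    ring
  have hsymm : IsSymmSndFDerivAt ℝ G y := hG.isSymmSndFDerivAt (by simp; exact ENat.LEInfty.out)
  have huv := key u v
  rw [hsymm.eq u v, key v u] at huv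
  have sw : ∀ a : E, G y w a = G y a w := fun a => h.symm y hy w a
  simp only [curvatureOperator, map_add, map_sub, add_apply,
    sub_apply]
  simp only [sw] at huv
  linarith

/-- A parallel endomorphism field commutes with the curvature operators: differentiate
`∂_v J = J Γ_v - Γ_v J` along `u` and skew-symmetrize. -/
lemma curvatureOperator_comm (h : IsMetricOn G s) (hs : IsOpen s) {J : E → E →L[ℝ] E}
    (hJ : ContDiffOn ℝ ∞ J s)
    (hpar : ∀ y ∈ s, ∀ u v : E, fderiv ℝ J y u v
      = J y (christoffelCLM G y u v) - christoffelCLM G y u (J y v))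
    {y : E} (hy : y ∈ s) (u v w : E) :
    curvatureOperator (christoffelCLM G) y u v (J y w)
      = J y (curvatureOperator (christoffelCLM G) y u v w) := by
  set Γ := christoffelCLM G with hΓdef
  have hΓ := h.hasFDerivAt_christoffelCLM hs hy
  have hJy : ContDiffAt ℝ ∞ J y := hJ.contDiffAt (hs.mem_nhds hy)
  have hd : HasFDerivAt J (fderiv ℝ J y) y := (hJy.differentiableAt (by simp)).hasFDerivAt
  have hDD : HasFDerivAt (fderiv ℝ J) (fderiv ℝ (fderiv ℝ J) y) y :=
    ((hJy.fderiv_right (m := ∞) (by simp)).differentiableAt (by simp)).hasFDerivAt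
  have key : ∀ a b : E, fderiv ℝ (fderiv ℝ J) y a b w
      = (J y (Γ y a (Γ y b w)) - Γ y a (J y (Γ y b w))) + J y (fderiv ℝ Γ y a b w)
        - (fderiv ℝ Γ y a b (J y w) + Γ y b (J y (Γ y a w) - Γ y a (J y w))) := by
    intro a b
    have h1 := (hDD.clm_apply (hasFDerivAt_const b y)).clm_apply (hasFDerivAt_const w y)
    have h2 := (hd.clm_apply ((hΓ.clm_apply (hasFDerivAt_const b y)).clm_apply
      (hasFDerivAt_const w y))).sub ((hΓ.clm_apply (hasFDerivAt_const b y)).clm_apply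
      (hd.clm_apply (hasFDerivAt_const w y)))
    have heq : (fun x => fderiv ℝ J x b w) =ᶠ[𝓝 y]
        (fun x => J x (Γ x b w)) - fun x => Γ x b (J x w) := by
      filter_upwards [hs.mem_nhds hy] with x hx using hpar x hx b w
    have h3 := congrArg (fun L : E →L[ℝ] E => L a) (h1.unique (h2.congr_of_eventuallyEq heq))
    simp at h3
    rw [h3, hpar y hy, hpar y hy, map_sub]
    abel
  have hsymm : IsSymmSndFDerivAt ℝ J y := hJy.isSymmSndFDerivAt (by simp; exact ENat.LEInfty.out)
  have huv := key u v
  rw [hsymm.eq u v, key v u] at huv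
  simp only [curvatureOperator, map_add, map_sub] at huv ⊢
  rw [← sub_eq_zero] at huv ⊢
  rw [← huv]
  abel

end IsMetricOn

end CoordinateGeometry

/-! ### The Gauss equation in coordinates -/

section CoordinateImmersion

variable {E : Type*} [NormedAddCommGroup E] [NormedSpace ℝ E] [FiniteDimensional ℝ E]
  {F : Type*} [NormedAddCommGroup F] [NormedSpace ℝ F] [FiniteDimensional ℝ F]

/-- `f : F → E` is an immersion of the open set `s` into the open set `t` carrying the metric `G`,
and `γ` is the metric it induces on `s`. -/
structure IsIsometricImmersionOn (G : E → E →L[ℝ] E →L[ℝ] ℝ) (t : Set E)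
    (γ : F → F →L[ℝ] F →L[ℝ] ℝ) (s : Set F) (f : F → E) : Prop where
  isOpen_source : IsOpen s
  isOpen_target : IsOpen t
  metric : IsMetricOn G t
  contDiffOn : ContDiffOn ℝ ∞ f s
  mapsTo : Set.MapsTo f s t
  injective : ∀ x ∈ s, Function.Injective (fderiv ℝ f x)
  induced : ∀ x ∈ s, ∀ u v, γ x u v = G (f x) (fderiv ℝ f x u) (fderiv ℝ f x v)

/-- The derivative along `u` of the vector field `f' v` along `f`, with respect to the connection of
the ambient metric `G`: the sum of the second fundamental form and of `f'` applied to the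
connection of the induced metric. -/
def pullbackConnection (G : E → E →L[ℝ] E →L[ℝ] ℝ) (f : F → E) (x u v : F) : E :=
  fderiv ℝ (fderiv ℝ f) x u v + christoffelCLM G (f x) (fderiv ℝ f x u) (fderiv ℝ f x v)

/-- The second fundamental form of an immersion `f` between coordinate domains, with metric `γ` on
the source and `G` on the target. -/
def coordSecondFundamentalForm (G : E → E →L[ℝ] E →L[ℝ] ℝ) (γ : F → F →L[ℝ] F →L[ℝ] ℝ)
    (f : F → E) (x u v : F) : E :=
  pullbackConnection G f x u v - fderiv ℝ f x (christoffelCLM γ x u v)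

namespace IsIsometricImmersionOn

variable {G : E → E →L[ℝ] E →L[ℝ] ℝ} {t : Set E} {γ : F → F →L[ℝ] F →L[ℝ] ℝ} {s : Set F}
  {f : F → E}

lemma contDiffAt (h : IsIsometricImmersionOn G t γ s f) {x : F} (hx : x ∈ s) :
    ContDiffAt ℝ ∞ f x :=
  h.contDiffOn.contDiffAt (h.isOpen_source.mem_nhds hx)

lemma hasFDerivAt (h : IsIsometricImmersionOn G t γ s f) {x : F} (hx : x ∈ s) :
    HasFDerivAt f (fderiv ℝ f x) x :=
  ((h.contDiffAt hx).differentiableAt (by simp)).hasFDerivAt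

lemma hasFDerivAt_fderiv (h : IsIsometricImmersionOn G t γ s f) {x : F} (hx : x ∈ s) :
    HasFDerivAt (fderiv ℝ f) (fderiv ℝ (fderiv ℝ f) x) x :=
  (((h.contDiffAt hx).fderiv_right (m := ∞) (by simp)).differentiableAt (by simp)).hasFDerivAt

lemma hasFDerivAt_fderiv_fderiv (h : IsIsometricImmersionOn G t γ s f) {x : F} (hx : x ∈ s) :
    HasFDerivAt (fderiv ℝ (fderiv ℝ f)) (fderiv ℝ (fderiv ℝ (fderiv ℝ f)) x) x :=
  ((((h.contDiffAt hx).fderiv_right (m := ∞) (by simp)).fderiv_right (m := ∞)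
    (by simp)).differentiableAt (by simp)).hasFDerivAt

lemma fderiv_fderiv_symm (h : IsIsometricImmersionOn G t γ s f) {x : F} (hx : x ∈ s) (u v : F) :
    fderiv ℝ (fderiv ℝ f) x u v = fderiv ℝ (fderiv ℝ f) x v u := by
  have : IsSymmSndFDerivAt ℝ f x :=
    (h.contDiffAt hx).isSymmSndFDerivAt (by simp; exact ENat.LEInfty.out)
  exact this.eq u v

lemma isMetricOn_source (h : IsIsometricImmersionOn G t γ s f) : IsMetricOn γ s where
  contDiffOn := by
    rw [contDiffOn_clm_apply]
    intro u
    rw [contDiffOn_clm_apply]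
    intro v
    have hD : ContDiffOn ℝ ∞ (fderiv ℝ f) s := fun x hx =>
      ((h.contDiffAt hx).fderiv_right (m := ∞) (by simp)).contDiffWithinAt
    have : ContDiffOn ℝ ∞ (fun x => G (f x) (fderiv ℝ f x u) (fderiv ℝ f x v)) s :=
      ((h.metric.contDiffOn.comp h.contDiffOn h.mapsTo).clm_apply
        (hD.clm_apply contDiffOn_const)).clm_apply (hD.clm_apply contDiffOn_const)
    exact this.congr fun x hx => h.induced x hx u v
  symm := fun x hx v w => by
    rw [h.induced x hx, h.induced x hx, h.metric.symm _ (h.mapsTo hx)]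
  pos := fun x hx v hv => by
    rw [h.induced x hx]
    refine h.metric.pos _ (h.mapsTo hx) _ fun h0 => hv (h.injective x hx ?_)
    rw [h0, map_zero]

lemma pullbackConnection_symm (h : IsIsometricImmersionOn G t γ s f) {x : F} (hx : x ∈ s)
    (u v : F) : pullbackConnection G f x u v = pullbackConnection G f x v u := by
  rw [pullbackConnection, pullbackConnection, h.fderiv_fderiv_symm hx,
    h.metric.christoffelCLM_symm h.isOpen_target (h.mapsTo hx)]

lemma fderiv_induced (h : IsIsometricImmersionOn G t γ s f) {x : F} (hx : x ∈ s) (u v w : F) :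
    fderiv ℝ γ x u v w = G (f x) (pullbackConnection G f x u v) (fderiv ℝ f x w)
      + G (f x) (fderiv ℝ f x v) (pullbackConnection G f x u w) := by
  have hγ := h.isMetricOn_source.hasFDerivAt h.isOpen_source hx
  have hf := h.hasFDerivAt hx
  have hD := h.hasFDerivAt_fderiv hx
  have hG := (h.metric.hasFDerivAt h.isOpen_target (h.mapsTo hx)).comp x hf
  have h1 := (hγ.clm_apply (hasFDerivAt_const v x)).clm_apply (hasFDerivAt_const w x)
  have h2 := (hG.clm_apply (hD.clm_apply (hasFDerivAt_const v x))).clm_apply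
    (hD.clm_apply (hasFDerivAt_const w x))
  have heq : (fun x => γ x v w) =ᶠ[𝓝 x]
      fun x => (G ∘ f) x (fderiv ℝ f x v) (fderiv ℝ f x w) := by
    filter_upwards [h.isOpen_source.mem_nhds hx] with x' hx' using h.induced x' hx' v w
  have h3 := congrArg (fun L : F →L[ℝ] ℝ => L u) (h1.unique (h2.congr_of_eventuallyEq heq))
  simp at h3
  rw [h3, h.metric.fderiv_eq h.isOpen_target (h.mapsTo hx)]
  simp only [pullbackConnection, map_add, add_apply]
  ring

/-- The tangential part of the ambient connection is the connection of the induced metric: both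
are symmetric and compatible with the induced metric. -/
lemma apply_pullbackConnection (h : IsIsometricImmersionOn G t γ s f) {x : F} (hx : x ∈ s)
    (u v w : F) :
    G (f x) (pullbackConnection G f x u v) (fderiv ℝ f x w) = γ x (christoffelCLM γ x u v) w := by
  have hm := h.isMetricOn_source
  have e := fun a b c => h.fderiv_induced hx a b c
  have e' := fun a b c => hm.fderiv_eq h.isOpen_source hx a b c
  have sw : ∀ a b, G (f x) (fderiv ℝ f x a) b = G (f x) b (fderiv ℝ f x a) :=
    fun a b => h.metric.symm _ (h.mapsTo hx) _ _
  have sw' : ∀ a b c, γ x a (christoffelCLM γ x b c) = γ x (christoffelCLM γ x b c) a :=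
    fun a b c => hm.symm x hx _ _
  simp only [sw] at e
  simp only [sw'] at e'
  have p := fun a b => h.pullbackConnection_symm hx a b
  have q := fun a b => hm.christoffelCLM_symm h.isOpen_source hx a b
  have e1 := e u v w
  have e2 := e v w u
  have e3 := e w u v
  have f1 := e' u v w
  have f2 := e' v w u
  have f3 := e' w u v
  rw [p v u] at e2
  rw [p w u, p w v] at e3
  rw [q v u] at f2
  rw [q w u, q w v] at f3
  linarith

/-- The second fundamental form takes values in the normal space. -/
lemma apply_coordSecondFundamentalForm (h : IsIsometricImmersionOn G t γ s f) {x : F} (hx : x ∈ s)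
    (u v w : F) :
    G (f x) (coordSecondFundamentalForm G γ f x u v) (fderiv ℝ f x w) = 0 := by
  rw [coordSecondFundamentalForm, map_sub, sub_apply, h.apply_pullbackConnection hx,
    h.induced x hx, sub_self]

lemma coordSecondFundamentalForm_symm (h : IsIsometricImmersionOn G t γ s f) {x : F} (hx : x ∈ s)
    (u v : F) :
    coordSecondFundamentalForm G γ f x u v = coordSecondFundamentalForm G γ f x v u := by
  rw [coordSecondFundamentalForm, coordSecondFundamentalForm, h.pullbackConnection_symm hx,
    h.isMetricOn_source.christoffelCLM_symm h.isOpen_source hx]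

lemma inner_pullbackConnection (h : IsIsometricImmersionOn G t γ s f) {x : F} (hx : x ∈ s)
    (a b c d : F) :
    G (f x) (pullbackConnection G f x a b) (pullbackConnection G f x c d)
      = G (f x) (coordSecondFundamentalForm G γ f x a b) (coordSecondFundamentalForm G γ f x c d)
        + γ x (christoffelCLM γ x a b) (christoffelCLM γ x c d) := by
  have e : ∀ a b, pullbackConnection G f x a b = coordSecondFundamentalForm G γ f x a b
      + fderiv ℝ f x (christoffelCLM γ x a b) := fun a b => by
    rw [coordSecondFundamentalForm, sub_add_cancel]
  rw [e a b, e c d]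
  simp only [map_add, add_apply]
  rw [h.apply_coordSecondFundamentalForm hx, h.metric.symm _ (h.mapsTo hx) (fderiv ℝ f x _),
    h.apply_coordSecondFundamentalForm hx, h.induced x hx]
  ring

lemma hasFDerivAt_pullbackConnection (h : IsIsometricImmersionOn G t γ s f) {x : F} (hx : x ∈ s)
    (u v w : F) :
    ∃ L : F →L[ℝ] E, HasFDerivAt (fun x => pullbackConnection G f x v w) L x ∧
      L u = fderiv ℝ (fderiv ℝ (fderiv ℝ f)) x u v w
        + (fderiv ℝ (christoffelCLM G) (f x) (fderiv ℝ f x u) (fderiv ℝ f x v) (fderiv ℝ f x w)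
        + christoffelCLM G (f x) (fderiv ℝ (fderiv ℝ f) x u v) (fderiv ℝ f x w)
        + christoffelCLM G (f x) (fderiv ℝ f x v) (fderiv ℝ (fderiv ℝ f) x u w)) := by
  have hf := h.hasFDerivAt hx
  have hD := h.hasFDerivAt_fderiv hx
  have hDD := h.hasFDerivAt_fderiv_fderiv hx
  have hΓ := (h.metric.hasFDerivAt_christoffelCLM h.isOpen_target (h.mapsTo hx)).comp x hf
  refine ⟨_, ((hDD.clm_apply (hasFDerivAt_const v x)).clm_apply (hasFDerivAt_const w x)).add
    ((hΓ.clm_apply (hD.clm_apply (hasFDerivAt_const v x))).clm_apply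
      (hD.clm_apply (hasFDerivAt_const w x))), ?_⟩
  simp
  abel

/-- **Gauss equation**. -/
lemma gauss (h : IsIsometricImmersionOn G t γ s f) {x : F} (hx : x ∈ s) (u v w z : F) :
    γ x (curvatureOperator (christoffelCLM γ) x u v w) z
      = G (f x) (curvatureOperator (christoffelCLM G) (f x) (fderiv ℝ f x u) (fderiv ℝ f x v)
          (fderiv ℝ f x w)) (fderiv ℝ f x z)
        + G (f x) (coordSecondFundamentalForm G γ f x v w) (coordSecondFundamentalForm G γ f x u z)
        - G (f x) (coordSecondFundamentalForm G γ f x u w)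
          (coordSecondFundamentalForm G γ f x v z) := by
  have hm := h.isMetricOn_source
  have key : ∀ a b : F,
      G (f x) (fderiv ℝ (fderiv ℝ (fderiv ℝ f)) x a b w
        + (fderiv ℝ (christoffelCLM G) (f x) (fderiv ℝ f x a) (fderiv ℝ f x b) (fderiv ℝ f x w)
        + christoffelCLM G (f x) (fderiv ℝ (fderiv ℝ f) x a b) (fderiv ℝ f x w)
        + christoffelCLM G (f x) (fderiv ℝ f x b) (fderiv ℝ (fderiv ℝ f) x a w))
        + christoffelCLM G (f x) (fderiv ℝ f x a) (pullbackConnection G f x b w)) (fderiv ℝ f x z)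
      + G (f x) (pullbackConnection G f x b w) (pullbackConnection G f x a z)
      = γ x (fderiv ℝ (christoffelCLM γ) x a b w
          + christoffelCLM γ x a (christoffelCLM γ x b w)) z
        + γ x (christoffelCLM γ x b w) (christoffelCLM γ x a z) := by
    intro a b
    have hG := (h.metric.hasFDerivAt h.isOpen_target (h.mapsTo hx)).comp x (h.hasFDerivAt hx)
    obtain ⟨L, hL, hLa⟩ := h.hasFDerivAt_pullbackConnection hx a b w
    have h1 := (hG.clm_apply hL).clm_apply
      ((h.hasFDerivAt_fderiv hx).clm_apply (hasFDerivAt_const z x))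
    have h2 := ((hm.hasFDerivAt h.isOpen_source hx).clm_apply
      (((hm.hasFDerivAt_christoffelCLM h.isOpen_source hx).clm_apply
        (hasFDerivAt_const b x)).clm_apply (hasFDerivAt_const w x))).clm_apply
      (hasFDerivAt_const z x)
    have heq : (fun x => (G ∘ f) x (pullbackConnection G f x b w) (fderiv ℝ f x z)) =ᶠ[𝓝 x]
        fun x => γ x (christoffelCLM γ x b w) z := by
      filter_upwards [h.isOpen_source.mem_nhds hx] with x' hx'
        using h.apply_pullbackConnection hx' b w z
    have h3 := congrArg (fun L : F →L[ℝ] ℝ => L a) (h1.unique (h2.congr_of_eventuallyEq heq))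
    simp [hLa] at h3
    rw [h.metric.fderiv_eq h.isOpen_target (h.mapsTo hx), hm.fderiv_eq h.isOpen_source hx] at h3
    rw [show pullbackConnection G f x a z = fderiv ℝ (fderiv ℝ f) x a z
      + christoffelCLM G (f x) (fderiv ℝ f x a) (fderiv ℝ f x z) from rfl]
    simp only [map_add, add_apply] at h3 ⊢
    linarith
  have hsymm : fderiv ℝ (fderiv ℝ (fderiv ℝ f)) x u v = fderiv ℝ (fderiv ℝ (fderiv ℝ f)) x v u := by
    have : IsSymmSndFDerivAt ℝ (fderiv ℝ f) x :=
      ((h.contDiffAt hx).fderiv_right (m := ∞) (by simp)).isSymmSndFDerivAt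
        (by simp; exact ENat.LEInfty.out)
    exact this.eq u v
  have k1 := key u v
  have k2 := key v u
  rw [h.inner_pullbackConnection hx] at k1 k2
  rw [hsymm, h.fderiv_fderiv_symm hx u v] at k1
  simp only [pullbackConnection, curvatureOperator, map_add, map_sub, add_apply, sub_apply]
    at k1 k2 ⊢
  linarith

/-- If the tangent spaces are totally real for a parallel complex structure `J`, differentiating
`G(J f' v, f' w) = 0` relates the second fundamental form in different arguments. -/
lemma coordSecondFundamentalForm_comm (h : IsIsometricImmersionOn G t γ s f) {J : E → E →L[ℝ] E}
    (hJ : ContDiffOn ℝ ∞ J t)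
    (hpar : ∀ y ∈ t, ∀ u v : E, fderiv ℝ J y u v
      = J y (christoffelCLM G y u v) - christoffelCLM G y u (J y v))
    (hlag : ∀ x ∈ s, ∀ v w, G (f x) (J (f x) (fderiv ℝ f x v)) (fderiv ℝ f x w) = 0)
    {x : F} (hx : x ∈ s) (u v w : F) :
    G (f x) (J (f x) (coordSecondFundamentalForm G γ f x u v)) (fderiv ℝ f x w)
      + G (f x) (J (f x) (fderiv ℝ f x v)) (coordSecondFundamentalForm G γ f x u w) = 0 := by
  have hf := h.hasFDerivAt hx
  have hD := h.hasFDerivAt_fderiv hx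
  have hG := (h.metric.hasFDerivAt h.isOpen_target (h.mapsTo hx)).comp x hf
  have hJx := (((hJ.contDiffAt (h.isOpen_target.mem_nhds (h.mapsTo hx))).differentiableAt
    (by simp)).hasFDerivAt).comp x hf
  have h1 := (hG.clm_apply (hJx.clm_apply (hD.clm_apply (hasFDerivAt_const v x)))).clm_apply
    (hD.clm_apply (hasFDerivAt_const w x))
  have heq : (fun x => (G ∘ f) x ((J ∘ f) x (fderiv ℝ f x v)) (fderiv ℝ f x w)) =ᶠ[𝓝 x]
      fun _ => (0 : ℝ) := by
    filter_upwards [h.isOpen_source.mem_nhds hx] with x' hx' using hlag x' hx' v w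
  have h3 := congrArg (fun L : F →L[ℝ] ℝ => L u)
    (h1.unique ((hasFDerivAt_const (0 : ℝ) x).congr_of_eventuallyEq heq))
  simp at h3
  rw [h.metric.fderiv_eq h.isOpen_target (h.mapsTo hx), hpar _ (h.mapsTo hx)] at h3
  simp only [coordSecondFundamentalForm, pullbackConnection, map_add, map_sub, add_apply,
    sub_apply, hlag x hx] at h3 ⊢
  linarith

end IsIsometricImmersionOn

end CoordinateImmersion

/-! ### Metrics and immersions in the preferred charts -/

section Charts

variable {E : Type*} [NormedAddCommGroup E] [NormedSpace ℝ E]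
  {M : Type*} [TopologicalSpace M] [ChartedSpace E M] [IsManifold 𝓘(ℝ, E) ∞ M]

lemma mfderiv_extChartAt_symm_apply_mfderiv {p : M} {y : E}
    (hy : y ∈ (extChartAt 𝓘(ℝ, E) p).target) (v : E) :
    mfderiv 𝓘(ℝ, E) 𝓘(ℝ, E) (extChartAt 𝓘(ℝ, E) p).symm y
      (mfderiv 𝓘(ℝ, E) 𝓘(ℝ, E) (extChartAt 𝓘(ℝ, E) p) ((extChartAt 𝓘(ℝ, E) p).symm y) v) = v := by
  have := mfderivWithin_extChartAt_symm_comp_mfderiv_extChartAt (I := 𝓘(ℝ, E)) hy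
  simp only [modelWithCornersSelf_coe, Set.range_id, mfderivWithin_univ] at this
  exact congrArg (fun L : E →L[ℝ] E => L v) this

lemma mfderiv_extChartAt_apply_mfderiv_symm {p : M} {y : E}
    (hy : y ∈ (extChartAt 𝓘(ℝ, E) p).target) (v : E) :
    mfderiv 𝓘(ℝ, E) 𝓘(ℝ, E) (extChartAt 𝓘(ℝ, E) p) ((extChartAt 𝓘(ℝ, E) p).symm y)
      (mfderiv 𝓘(ℝ, E) 𝓘(ℝ, E) (extChartAt 𝓘(ℝ, E) p).symm y v) = v := by
  have := mfderiv_extChartAt_comp_mfderivWithin_extChartAt_symm (I := 𝓘(ℝ, E)) hy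
  simp only [modelWithCornersSelf_coe, Set.range_id, mfderivWithin_univ] at this
  exact congrArg (fun L : E →L[ℝ] E => L v) this

lemma mfderiv_extChartAt_symm_self (p : M) (v : E) :
    mfderiv 𝓘(ℝ, E) 𝓘(ℝ, E) (extChartAt 𝓘(ℝ, E) p).symm (extChartAt 𝓘(ℝ, E) p p) v = v := by
  have := mfderivWithin_range_extChartAt_symm (I := 𝓘(ℝ, E)) (x := p)
  simp only [modelWithCornersSelf_coe, Set.range_id, mfderivWithin_univ] at this
  exact congrArg (fun L : E →L[ℝ] E => L v) this

lemma metricInChart_apply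
    (g : ∀ x : M, TangentSpace 𝓘(ℝ, E) x →L[ℝ] TangentSpace 𝓘(ℝ, E) x →L[ℝ] ℝ) (p : M)
    (y v w : E) :
    metricInChart g p y v w = g ((extChartAt 𝓘(ℝ, E) p).symm y)
      (mfderiv 𝓘(ℝ, E) 𝓘(ℝ, E) (extChartAt 𝓘(ℝ, E) p).symm y v)
      (mfderiv 𝓘(ℝ, E) 𝓘(ℝ, E) (extChartAt 𝓘(ℝ, E) p).symm y w) :=
  rfl

lemma endoInChart_apply
    (J : ∀ x : M, TangentSpace 𝓘(ℝ, E) x →L[ℝ] TangentSpace 𝓘(ℝ, E) x) (p : M) (y v : E) :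
    endoInChart J p y v =
      mfderiv 𝓘(ℝ, E) 𝓘(ℝ, E) (extChartAt 𝓘(ℝ, E) p) ((extChartAt 𝓘(ℝ, E) p).symm y)
        (J ((extChartAt 𝓘(ℝ, E) p).symm y)
          (mfderiv 𝓘(ℝ, E) 𝓘(ℝ, E) (extChartAt 𝓘(ℝ, E) p).symm y v)) :=
  rfl

lemma metricInChart_self
    (g : ∀ x : M, TangentSpace 𝓘(ℝ, E) x →L[ℝ] TangentSpace 𝓘(ℝ, E) x →L[ℝ] ℝ) (p : M)
    (v w : E) : metricInChart g p (extChartAt 𝓘(ℝ, E) p p) v w = g p v w := by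
  rw [metricInChart_apply, mfderiv_extChartAt_symm_self, mfderiv_extChartAt_symm_self,
    extChartAt_to_inv]

lemma endoInChart_self
    (J : ∀ x : M, TangentSpace 𝓘(ℝ, E) x →L[ℝ] TangentSpace 𝓘(ℝ, E) x) (p : M) (v : E) :
    endoInChart J p (extChartAt 𝓘(ℝ, E) p p) v = J p v := by
  rw [endoInChart_apply, mfderiv_extChartAt_symm_self, extChartAt_to_inv]
  exact congrArg (fun L : E →L[ℝ] E => L (J p v)) (mfderiv_extChartAt_self (I := 𝓘(ℝ, E)) (x := p))

variable [FiniteDimensional ℝ E]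

lemma isMetricOn_metricInChart
    (g : ContMDiffRiemannianMetric 𝓘(ℝ, E) ∞ E (fun x : M => TangentSpace 𝓘(ℝ, E) x)) (p : M) :
    IsMetricOn (metricInChart g.inner p) (extChartAt 𝓘(ℝ, E) p).target where
  contDiffOn := by
    have ht : IsOpen (extChartAt 𝓘(ℝ, E) p).target := isOpen_extChartAt_target p
    have hσ := contMDiffOn_extChartAt_symm (I := 𝓘(ℝ, E)) (n := ∞) p
    have hfield : ∀ u : E, ContMDiffOn 𝓘(ℝ, E) 𝓘(ℝ, E).tangent ∞
        (fun y : E => (⟨(extChartAt 𝓘(ℝ, E) p).symm y,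
          mfderiv 𝓘(ℝ, E) 𝓘(ℝ, E) (extChartAt 𝓘(ℝ, E) p).symm y u⟩ : TangentBundle 𝓘(ℝ, E) M))
        (extChartAt 𝓘(ℝ, E) p).target := by
      intro u
      have h1 := hσ.contMDiffOn_tangentMapWithin (m := ∞) (by simp) ht.uniqueMDiffOn
      have h2 : ContMDiffOn 𝓘(ℝ, E) 𝓘(ℝ, E).tangent ∞
          (fun y : E => (⟨y, u⟩ : TangentBundle 𝓘(ℝ, E) E)) (extChartAt 𝓘(ℝ, E) p).target :=
        contMDiffOn_vectorSpace_iff_contDiffOn.2 contDiffOn_const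
      refine (h1.comp h2 fun y hy => hy).congr fun y hy => ?_
      simp only [Function.comp, tangentMapWithin, mfderivWithin_of_isOpen ht hy]
    rw [contDiffOn_clm_apply]
    intro u
    rw [contDiffOn_clm_apply]
    intro v
    have h3 := (g.contMDiff.comp_contMDiffOn hσ)
    have h4 := ContMDiffOn.clm_bundle_apply₂ (E₃ := Bundle.Trivial M ℝ) (F₃ := ℝ)
      h3 (hfield u) (hfield v)
    rw [← contMDiffOn_iff_contDiffOn]
    intro y hy
    have h5 := h4 y hy
    simp only [contMDiffWithinAt_totalSpace] at h5
    exact h5.2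
  symm := fun y _ v w => by
    rw [metricInChart_apply, metricInChart_apply, g.symm]
  pos := fun y hy v hv => by
    rw [metricInChart_apply]
    refine g.pos _ _ fun h0 => hv ?_
    rw [← mfderiv_extChartAt_apply_mfderiv_symm hy v, h0]
    exact map_zero _

variable {F : Type*} [NormedAddCommGroup F] [NormedSpace ℝ F] [FiniteDimensional ℝ F]
  {N : Type*} [TopologicalSpace N] [ChartedSpace F N] [IsManifold 𝓘(ℝ, F) ∞ N]

/-- The part of the image of the preferred chart of `N` around `p` on which the expression of
`ι : N → M` in the preferred charts is meaningful. -/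
def immersionDomain (E : Type*) [NormedAddCommGroup E] [NormedSpace ℝ E] {M : Type*}
    [TopologicalSpace M] [ChartedSpace E M] (ι : N → M) (p : N) : Set F :=
  (extChartAt 𝓘(ℝ, F) p).target ∩
    (extChartAt 𝓘(ℝ, F) p).symm ⁻¹' (ι ⁻¹' (extChartAt 𝓘(ℝ, E) (ι p)).source)

lemma mem_immersionDomain (ι : N → M) (p : N) :
    extChartAt 𝓘(ℝ, F) p p ∈ immersionDomain E ι p :=
  ⟨mem_extChartAt_target p, by simp⟩

lemma writtenInExtChartAt_self (ι : N → M) (p : N) :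
    writtenInExtChartAt 𝓘(ℝ, F) 𝓘(ℝ, E) p ι (extChartAt 𝓘(ℝ, F) p p)
      = extChartAt 𝓘(ℝ, E) (ι p) (ι p) := by
  simp [writtenInExtChartAt]

lemma fderiv_writtenInExtChartAt_self {ι : N → M} (hι : ContMDiff 𝓘(ℝ, F) 𝓘(ℝ, E) ∞ ι) (p : N) :
    fderiv ℝ (writtenInExtChartAt 𝓘(ℝ, F) 𝓘(ℝ, E) p ι) (extChartAt 𝓘(ℝ, F) p p)
      = mfderiv 𝓘(ℝ, F) 𝓘(ℝ, E) ι p := by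
  rw [MDifferentiableAt.mfderiv (hι.mdifferentiableAt (by simp))]
  simp only [modelWithCornersSelf_coe, Set.range_id, fderivWithin_univ]

/-- The derivative of the inverse chart of `M`, applied to the derivative of the chart expression of
`ι`, is the derivative of `ι`: the derivatives of the chart of `M` cancel. -/
lemma mfderiv_symm_apply_fderiv_writtenInExtChartAt {ι : N → M}
    (hι : ContMDiff 𝓘(ℝ, F) 𝓘(ℝ, E) ∞ ι) (p : N) {y : F} (hy : y ∈ immersionDomain E ι p) (v : F) :
    mfderiv 𝓘(ℝ, E) 𝓘(ℝ, E) (extChartAt 𝓘(ℝ, E) (ι p)).symm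
        (writtenInExtChartAt 𝓘(ℝ, F) 𝓘(ℝ, E) p ι y)
        (fderiv ℝ (writtenInExtChartAt 𝓘(ℝ, F) 𝓘(ℝ, E) p ι) y v)
      = mfderiv 𝓘(ℝ, F) 𝓘(ℝ, E) ι ((extChartAt 𝓘(ℝ, F) p).symm y)
        (mfderiv 𝓘(ℝ, F) 𝓘(ℝ, F) (extChartAt 𝓘(ℝ, F) p).symm y v) := by
  have hσ : MDifferentiableAt 𝓘(ℝ, F) 𝓘(ℝ, F) (extChartAt 𝓘(ℝ, F) p).symm y := by
    have := mdifferentiableWithinAt_extChartAt_symm (I := 𝓘(ℝ, F)) hy.1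
    simpa only [modelWithCornersSelf_coe, Set.range_id, mdifferentiableWithinAt_univ] using this
  have hφ : MDifferentiableAt 𝓘(ℝ, E) 𝓘(ℝ, E) (extChartAt 𝓘(ℝ, E) (ι p))
      (ι ((extChartAt 𝓘(ℝ, F) p).symm y)) :=
    mdifferentiableAt_extChartAt (by simpa using hy.2)
  have hd := hφ.hasMFDerivAt.comp y
    (((hι.mdifferentiableAt (by simp)).hasMFDerivAt).comp y hσ.hasMFDerivAt)
  have hf : fderiv ℝ (writtenInExtChartAt 𝓘(ℝ, F) 𝓘(ℝ, E) p ι) y =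
      (mfderiv 𝓘(ℝ, E) 𝓘(ℝ, E) (extChartAt 𝓘(ℝ, E) (ι p)) (ι ((extChartAt 𝓘(ℝ, F) p).symm y)) :
        E →L[ℝ] E) ∘L
      (mfderiv 𝓘(ℝ, F) 𝓘(ℝ, E) ι ((extChartAt 𝓘(ℝ, F) p).symm y) : F →L[ℝ] E) ∘L
      (mfderiv 𝓘(ℝ, F) 𝓘(ℝ, F) (extChartAt 𝓘(ℝ, F) p).symm y : F →L[ℝ] F) :=
    HasFDerivAt.fderiv hd.hasFDerivAt
  have hy' : writtenInExtChartAt 𝓘(ℝ, F) 𝓘(ℝ, E) p ι y ∈ (extChartAt 𝓘(ℝ, E) (ι p)).target :=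
    (extChartAt 𝓘(ℝ, E) (ι p)).map_source hy.2
  have hinv : (extChartAt 𝓘(ℝ, E) (ι p)).symm (writtenInExtChartAt 𝓘(ℝ, F) 𝓘(ℝ, E) p ι y)
      = ι ((extChartAt 𝓘(ℝ, F) p).symm y) := (extChartAt 𝓘(ℝ, E) (ι p)).left_inv hy.2
  have hc := mfderiv_extChartAt_symm_apply_mfderiv hy'
    (mfderiv 𝓘(ℝ, F) 𝓘(ℝ, E) ι ((extChartAt 𝓘(ℝ, F) p).symm y)
        (mfderiv 𝓘(ℝ, F) 𝓘(ℝ, F) (extChartAt 𝓘(ℝ, F) p).symm y v))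
  rw [hinv] at hc
  rw [hf]
  exact hc

lemma isIsometricImmersionOn_writtenInExtChartAt
    (g : ContMDiffRiemannianMetric 𝓘(ℝ, E) ∞ E (fun x : M => TangentSpace 𝓘(ℝ, E) x))
    {ι : N → M} (hι : ContMDiff 𝓘(ℝ, F) 𝓘(ℝ, E) ∞ ι)
    (hinj : ∀ p : N, Function.Injective (mfderiv 𝓘(ℝ, F) 𝓘(ℝ, E) ι p)) (p : N) :
    IsIsometricImmersionOn (metricInChart g.inner (ι p)) (extChartAt 𝓘(ℝ, E) (ι p)).target
      (metricInChart (inducedMetric g ι) p) (immersionDomain E ι p)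
      (writtenInExtChartAt 𝓘(ℝ, F) 𝓘(ℝ, E) p ι) where
  isOpen_source := by
    refine (continuousOn_extChartAt_symm p).isOpen_inter_preimage (isOpen_extChartAt_target p) ?_
    exact (isOpen_extChartAt_source (I := 𝓘(ℝ, E)) (ι p)).preimage hι.continuous
  isOpen_target := isOpen_extChartAt_target (ι p)
  metric := isMetricOn_metricInChart g (ι p)
  contDiffOn := by
    rw [← contMDiffOn_iff_contDiffOn]
    have h1 := contMDiffOn_extChartAt_symm (I := 𝓘(ℝ, F)) (n := ∞) p
    have h2 := contMDiffOn_extChartAt (I := 𝓘(ℝ, E)) (n := ∞) (x := ι p)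
    refine h2.comp ((hι.comp_contMDiffOn h1).mono Set.inter_subset_left) fun y hy => ?_
    simpa using hy.2
  mapsTo := fun y hy => (extChartAt 𝓘(ℝ, E) (ι p)).map_source hy.2
  injective := fun y hy => by
    rw [injective_iff_map_eq_zero]
    intro v hv
    have h1 := mfderiv_symm_apply_fderiv_writtenInExtChartAt hι p hy v
    rw [hv] at h1
    have h2 : mfderiv 𝓘(ℝ, F) 𝓘(ℝ, F) (extChartAt 𝓘(ℝ, F) p).symm y v = 0 :=
      hinj _ (h1.symm.trans ((map_zero _).trans (map_zero _).symm))
    rw [← mfderiv_extChartAt_apply_mfderiv_symm hy.1 v, h2]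
    exact map_zero _
  induced := fun y hy u v => by
    rw [metricInChart_apply, metricInChart_apply,
      mfderiv_symm_apply_fderiv_writtenInExtChartAt hι p hy,
      mfderiv_symm_apply_fderiv_writtenInExtChartAt hι p hy]
    have hinv : (extChartAt 𝓘(ℝ, E) (ι p)).symm (writtenInExtChartAt 𝓘(ℝ, F) 𝓘(ℝ, E) p ι y)
      = ι ((extChartAt 𝓘(ℝ, F) p).symm y) := (extChartAt 𝓘(ℝ, E) (ι p)).left_inv hy.2
    rw [hinv]
    rfl

lemma lagrangian_writtenInExtChartAt
    {g : ContMDiffRiemannianMetric 𝓘(ℝ, E) ∞ E (fun x : M => TangentSpace 𝓘(ℝ, E) x)}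
    {J : ∀ x : M, TangentSpace 𝓘(ℝ, E) x →L[ℝ] TangentSpace 𝓘(ℝ, E) x} {ι : N → M}
    (hι : IsLagrangianImmersion (F := F) g J ι) (p : N) {y : F} (hy : y ∈ immersionDomain E ι p)
    (v w : F) :
    metricInChart g.inner (ι p) (writtenInExtChartAt 𝓘(ℝ, F) 𝓘(ℝ, E) p ι y)
      (endoInChart J (ι p) (writtenInExtChartAt 𝓘(ℝ, F) 𝓘(ℝ, E) p ι y)
        (fderiv ℝ (writtenInExtChartAt 𝓘(ℝ, F) 𝓘(ℝ, E) p ι) y v))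
      (fderiv ℝ (writtenInExtChartAt 𝓘(ℝ, F) 𝓘(ℝ, E) p ι) y w) = 0 := by
  have hy' : writtenInExtChartAt 𝓘(ℝ, F) 𝓘(ℝ, E) p ι y ∈ (extChartAt 𝓘(ℝ, E) (ι p)).target :=
    (extChartAt 𝓘(ℝ, E) (ι p)).map_source hy.2
  have hinv : (extChartAt 𝓘(ℝ, E) (ι p)).symm (writtenInExtChartAt 𝓘(ℝ, F) 𝓘(ℝ, E) p ι y)
      = ι ((extChartAt 𝓘(ℝ, F) p).symm y) := (extChartAt 𝓘(ℝ, E) (ι p)).left_inv hy.2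
  have hJ := endoInChart_apply J (ι p) (writtenInExtChartAt 𝓘(ℝ, F) 𝓘(ℝ, E) p ι y)
    (fderiv ℝ (writtenInExtChartAt 𝓘(ℝ, F) 𝓘(ℝ, E) p ι) y v)
  rw [mfderiv_symm_apply_fderiv_writtenInExtChartAt hι.contMDiff p hy] at hJ
  rw [metricInChart_apply, hJ,
    mfderiv_symm_apply_fderiv_writtenInExtChartAt hι.contMDiff p hy]
  erw [mfderiv_extChartAt_symm_apply_mfderiv hy']
  rw [hinv]
  exact hι.lagrangian _ _ _

end Charts

/-! ### Kähler curvature tensors and holomorphic sectional curvature -/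

section KahlerTensor

variable {E : Type*} [NormedAddCommGroup E] [NormedSpace ℝ E]

/-- A positive definite symmetric form together with a compatible complex structure. -/
structure IsHermitianPair (G : E →L[ℝ] E →L[ℝ] ℝ) (J : E →L[ℝ] E) : Prop where
  symm : ∀ v w, G v w = G w v
  pos : ∀ v, v ≠ 0 → 0 < G v v
  sq : ∀ v, J (J v) = -v
  hermitian : ∀ v w, G (J v) (J w) = G v w

lemma IsHermitianPair.apply_J {G : E →L[ℝ] E →L[ℝ] ℝ} {J : E →L[ℝ] E} (h : IsHermitianPair G J)
    (v w : E) : G v (J w) = -G (J v) w := by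
  rw [← h.hermitian v, h.sq, map_neg]

lemma IsHermitianPair.apply_J_self {G : E →L[ℝ] E →L[ℝ] ℝ} {J : E →L[ℝ] E}
    (h : IsHermitianPair G J) (v : E) : G (J v) v = 0 := by
  have := h.apply_J v v
  rw [h.symm] at this
  linarith

/-- A covariant 4-tensor with the algebraic symmetries of the curvature of a Kähler metric. -/
structure IsKahlerTensor (J : E →L[ℝ] E) (T : E → E → E → E → ℝ) : Prop where
  add_left : ∀ x x' y z u, T (x + x') y z u = T x y z u + T x' y z u
  smul_left : ∀ (r : ℝ) x y z u, T (r • x) y z u = r * T x y z u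
  swap_left : ∀ x y z u, T x y z u = -T y x z u
  swap_right : ∀ x y z u, T x y z u = -T x y u z
  bianchi : ∀ x y z u, T x y z u + T y z x u + T z x y u = 0
  comm : ∀ x y z u, T x y (J z) (J u) = T x y z u

namespace IsKahlerTensor

variable {J : E →L[ℝ] E} {T T' : E → E → E → E → ℝ}

lemma pair_symm (h : IsKahlerTensor J T) (x y z u : E) : T x y z u = T z u x y := by
  have b1 := h.bianchi x y z u
  have b2 := h.bianchi y z u x
  have b3 := h.bianchi z u x y
  have b4 := h.bianchi u x y z
  rw [h.swap_left y z x u] at b1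
  rw [h.swap_right y z u x, h.swap_left z u y x, h.swap_right u z y x, h.swap_left u y z x,
    h.swap_right y u z x] at b2
  rw [h.swap_left u x z y, h.swap_right x u z y, h.swap_left x z u y, h.swap_right z x u y] at b3
  rw [h.swap_right u x y z, h.swap_left u x z y, h.swap_right x u z y, h.swap_right x y u z,
    h.swap_left y u x z] at b4
  have s1 := h.swap_left u z x y
  have s2 := h.swap_left z y x u
  have s3 := h.swap_right u y x z
  have s4 := h.swap_left u y x z
  have s5 := h.swap_right x u y z
  have s6 := h.swap_left z x y u
  have s7 := h.swap_right x z y u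
  have s8 := h.swap_left u z y x
  have s9 := h.swap_right z u y x
  linarith

lemma add_2 (h : IsKahlerTensor J T) (x y y' z u : E) :
    T x (y + y') z u = T x y z u + T x y' z u := by
  rw [h.swap_left, h.add_left, h.swap_left y, h.swap_left y']; ring

lemma add_3 (h : IsKahlerTensor J T) (x y z z' u : E) :
    T x y (z + z') u = T x y z u + T x y z' u := by
  rw [h.pair_symm, h.add_left, h.pair_symm z, h.pair_symm z']

lemma add_4 (h : IsKahlerTensor J T) (x y z u u' : E) :
    T x y z (u + u') = T x y z u + T x y z u' := by
  rw [h.pair_symm, h.add_2, h.pair_symm z, h.pair_symm z u']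

lemma smul_2 (h : IsKahlerTensor J T) (r : ℝ) (x y z u : E) :
    T x (r • y) z u = r * T x y z u := by
  rw [h.swap_left, h.smul_left, h.swap_left y]; ring

lemma smul_3 (h : IsKahlerTensor J T) (r : ℝ) (x y z u : E) :
    T x y (r • z) u = r * T x y z u := by
  rw [h.pair_symm, h.smul_left, h.pair_symm z]

lemma smul_4 (h : IsKahlerTensor J T) (r : ℝ) (x y z u : E) :
    T x y z (r • u) = r * T x y z u := by
  rw [h.pair_symm, h.smul_2, h.pair_symm z]

lemma comm_left (h : IsKahlerTensor J T) (x y z u : E) : T (J x) (J y) z u = T x y z u := by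
  rw [h.pair_symm, h.comm, h.pair_symm]

lemma add (h : IsKahlerTensor J T) (h' : IsKahlerTensor J T') :
    IsKahlerTensor J fun x y z u => T x y z u + T' x y z u where
  add_left x x' y z u := by rw [h.add_left, h'.add_left]; ring
  smul_left r x y z u := by rw [h.smul_left, h'.smul_left]; ring
  swap_left x y z u := by rw [h.swap_left, h'.swap_left]; ring
  swap_right x y z u := by rw [h.swap_right, h'.swap_right]; ring
  bianchi x y z u := by linarith [h.bianchi x y z u, h'.bianchi x y z u]
  comm x y z u := by rw [h.comm, h'.comm]

lemma smul (h : IsKahlerTensor J T) (r : ℝ) :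
    IsKahlerTensor J fun x y z u => r * T x y z u where
  add_left x x' y z u := by rw [h.add_left]; ring
  smul_left s x y z u := by rw [h.smul_left]; ring
  swap_left x y z u := by rw [h.swap_left]; ring
  swap_right x y z u := by rw [h.swap_right]; ring
  bianchi x y z u := by linear_combination r * h.bianchi x y z u
  comm x y z u := by rw [h.comm]

/-- The part of `T(X, JX, JX, X)` at `X = x + y` which is quadratic in `x` and in `y`. -/
def mixedTerm (J : E →L[ℝ] E) (T : E → E → E → E → ℝ) (x y : E) : ℝ :=
  T x (J x) (J y) y + T x (J y) (J x) y + T x (J y) (J y) x + T y (J x) (J x) y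
    + T y (J x) (J y) x + T y (J y) (J x) x

lemma apply_add_sub (h : IsKahlerTensor J T) (a b : ℝ) (x y : E) :
    T (a • x + b • y) (J (a • x + b • y)) (J (a • x + b • y)) (a • x + b • y)
      + T (a • x + (-b) • y) (J (a • x + (-b) • y)) (J (a • x + (-b) • y)) (a • x + (-b) • y)
    = 2 * a ^ 4 * T x (J x) (J x) x + 2 * a ^ 2 * b ^ 2 * mixedTerm J T x y
      + 2 * b ^ 4 * T y (J y) (J y) y := by
  simp only [mixedTerm, map_add, map_smul, h.add_left, h.add_2, h.add_3, h.add_4, h.smul_left,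
    h.smul_2, h.smul_3, h.smul_4]
  ring

lemma apply_smul (h : IsKahlerTensor J T) (a : ℝ) (x : E) :
    T (a • x) (J (a • x)) (J (a • x)) (a • x) = a ^ 4 * T x (J x) (J x) x := by
  simp only [map_smul, h.smul_left, h.smul_2, h.smul_3, h.smul_4]
  ring

/-- If `T(X, JX, JX, X)` vanishes identically, polarization and the Bianchi identity give
`T(x, y, y, x) + 3 T(x, Jy, Jy, x) = 0`. -/
lemma apply_add_three_mul (h : IsKahlerTensor J T) (hJ : ∀ v, J (J v) = -v)
    (h0 : ∀ x, T x (J x) (J x) x = 0) (x y : E) :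
    T x y y x + 3 * T x (J y) (J y) x = 0 := by
  have hm := h.apply_add_sub 1 1 x y
  simp only [h0] at hm
  have neg1 : ∀ x y z u, T (-x) y z u = -T x y z u := fun x y z u => by
    rw [← neg_one_smul ℝ x, h.smul_left]; ring
  have neg3 : ∀ x y z u, T x y (-z) u = -T x y z u := fun x y z u => by
    rw [← neg_one_smul ℝ z, h.smul_3]; ring
  have e1 : T x (J y) (J x) y = T x (J y) (J y) x := by
    rw [← h.comm x (J y) (J x) y, hJ, neg3, ← h.swap_right]
  have e2 : T y (J x) (J y) x = T x (J y) (J x) y := by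
    rw [h.pair_symm, h.swap_left, h.swap_right]; ring
  have e3 : T y (J x) (J x) y = T x (J y) (J x) y := by
    rw [← h.comm_left y (J x), hJ, h.swap_left, neg1]; ring
  have e4 : T y (J y) (J x) x = T x (J x) (J y) y := by
    rw [h.pair_symm, h.swap_left, h.swap_right]; ring
  have hb := h.bianchi x (J x) (J y) y
  rw [h.comm_left, h.swap_right x y x y, h.swap_left (J y) x, e1] at hb
  simp only [mixedTerm, e4, e3, e2, e1] at hm
  linarith

/-- A Kähler curvature tensor is determined by its holomorphic sectional curvatures. -/
lemma eq_zero (h : IsKahlerTensor J T) (hJ : ∀ v, J (J v) = -v)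
    (h0 : ∀ x, T x (J x) (J x) x = 0) (x y z u : E) : T x y z u = 0 := by
  have neg2 : ∀ x y z u, T x (-y) z u = -T x y z u := fun x y z u => by
    rw [← neg_one_smul ℝ y, h.smul_2]; ring
  have neg3 : ∀ x y z u, T x y (-z) u = -T x y z u := fun x y z u => by
    rw [← neg_one_smul ℝ z, h.smul_3]; ring
  have hs : ∀ x y, T x y y x = 0 := fun x y => by
    have h1 := h.apply_add_three_mul hJ h0 x y
    have h2 := h.apply_add_three_mul hJ h0 x (J y)
    rw [hJ, neg2, neg3] at h2
    linarith
  have hp : ∀ x y z, T x y z x = 0 := fun x y z => by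
    have h1 := hs x (y + z)
    rw [h.add_2, h.add_3, h.add_3, hs, hs, h.pair_symm x z, h.swap_left y x, h.swap_right x y x z]
      at h1
    linarith
  have hq : ∀ x y z u, T x y z u = -T u y z x := fun x y z u => by
    have h1 := hp (x + u) y z
    rw [h.add_left, h.add_4, h.add_4, hp, hp] at h1
    linarith
  have hc : ∀ x y z u, T x y z u = T z x y u := fun x y z u => by
    rw [hq, h.swap_left, h.pair_symm]; ring
  linarith [h.bianchi x y z u, hc x y z u, hc y z x u]

end IsKahlerTensor

/-- The tensor `π` of a Hermitian vector space. -/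
def modelPi (G : E →L[ℝ] E →L[ℝ] ℝ) (J : E →L[ℝ] E) (X Y Z U : E) : ℝ :=
  (G Y Z * G X U - G X Z * G Y U + G (J Y) Z * G (J X) U - G (J X) Z * G (J Y) U
    - 2 * G (J X) Y * G (J Z) U) / 4

/-- The tensor `Φ` of a Hermitian vector space with a distinguished vector `ξ`. -/
def modelPhi (G : E →L[ℝ] E →L[ℝ] ℝ) (J : E →L[ℝ] E) (ξ X Y Z U : E) : ℝ :=
  (G Y Z * (G ξ X * G ξ U + G (J ξ) X * G (J ξ) U)
    - G X Z * (G ξ Y * G ξ U + G (J ξ) Y * G (J ξ) U)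
    + G X U * (G ξ Y * G ξ Z + G (J ξ) Y * G (J ξ) Z)
    - G Y U * (G ξ X * G ξ Z + G (J ξ) X * G (J ξ) Z)
    + G (J Y) Z * (G ξ X * G (J ξ) U - G ξ U * G (J ξ) X)
    - G (J X) Z * (G ξ Y * G (J ξ) U - G ξ U * G (J ξ) Y)
    + G (J X) U * (G ξ Y * G (J ξ) Z - G ξ Z * G (J ξ) Y)
    - G (J Y) U * (G ξ X * G (J ξ) Z - G ξ Z * G (J ξ) X)
    - 2 * G (J X) Y * (G ξ Z * G (J ξ) U - G ξ U * G (J ξ) Z)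
    - 2 * G (J Z) U * (G ξ X * G (J ξ) Y - G ξ Y * G (J ξ) X)) / 8

/-- The tensor `Ψ` of a Hermitian vector space with a distinguished vector `ξ`. -/
def modelPsi (G : E →L[ℝ] E →L[ℝ] ℝ) (J : E →L[ℝ] E) (ξ X Y Z U : E) : ℝ :=
  G ξ Y * G ξ Z * G (J ξ) X * G (J ξ) U - G ξ X * G ξ Z * G (J ξ) Y * G (J ξ) U
    + G ξ X * G ξ U * G (J ξ) Y * G (J ξ) Z - G ξ Y * G ξ U * G (J ξ) X * G (J ξ) Z

namespace IsHermitianPair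

variable {G : E →L[ℝ] E →L[ℝ] ℝ} {J : E →L[ℝ] E}

lemma apply_J_comm (h : IsHermitianPair G J) (v w : E) : G (J v) w = -G (J w) v := by
  rw [h.symm, h.apply_J]

lemma isKahlerTensor_modelPi (h : IsHermitianPair G J) : IsKahlerTensor J (modelPi G J) where
  add_left x x' y z u := by simp only [modelPi, map_add, add_apply]; ring
  smul_left r x y z u := by simp only [modelPi, map_smul, smul_apply, smul_eq_mul]; ring
  swap_left x y z u := by
    simp only [modelPi, h.apply_J_comm y x]; ring
  swap_right x y z u := by
    simp only [modelPi, h.apply_J_comm u z]; ring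
  bianchi x y z u := by
    simp only [modelPi]
    rw [h.symm y x, h.symm z x, h.symm z y, h.apply_J_comm y x, h.apply_J_comm z x,
      h.apply_J_comm z y]
    ring
  comm x y z u := by
    simp only [modelPi, h.apply_J, h.sq, map_neg, neg_apply]; ring

lemma isKahlerTensor_modelPhi (h : IsHermitianPair G J) (ξ : E) :
    IsKahlerTensor J (modelPhi G J ξ) where
  add_left x x' y z u := by simp only [modelPhi, map_add, add_apply]; ring
  smul_left r x y z u := by simp only [modelPhi, map_smul, smul_apply, smul_eq_mul]; ring
  swap_left x y z u := by
    simp only [modelPhi, h.apply_J_comm y x]; ring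
  swap_right x y z u := by
    simp only [modelPhi, h.apply_J_comm u z]; ring
  bianchi x y z u := by
    simp only [modelPhi]
    rw [h.symm y x, h.symm z x, h.symm z y, h.apply_J_comm y x, h.apply_J_comm z x,
      h.apply_J_comm z y]
    ring
  comm x y z u := by
    simp only [modelPhi, h.apply_J, h.sq, map_neg, neg_apply]; ring

lemma isKahlerTensor_modelPsi (h : IsHermitianPair G J) (ξ : E) :
    IsKahlerTensor J (modelPsi G J ξ) where
  add_left x x' y z u := by simp only [modelPsi, map_add]; ring
  smul_left r x y z u := by simp only [modelPsi, map_smul, smul_eq_mul]; ring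
  swap_left x y z u := by simp only [modelPsi]; ring
  swap_right x y z u := by simp only [modelPsi]; ring
  bianchi x y z u := by simp only [modelPsi]; ring
  comm x y z u := by
    simp only [modelPsi, h.apply_J, h.sq, map_neg, neg_apply]; ring

lemma modelPi_apply (h : IsHermitianPair G J) (X : E) :
    modelPi G J X (J X) (J X) X = G X X ^ 2 := by
  simp only [modelPi, h.apply_J, h.sq, map_neg, neg_apply, h.apply_J_self]; ring

lemma modelPhi_apply (h : IsHermitianPair G J) (ξ X : E) :
    modelPhi G J ξ X (J X) (J X) X = G X X * (G ξ X ^ 2 + G (J ξ) X ^ 2) := by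
  simp only [modelPhi, h.apply_J, h.sq, map_neg, neg_apply, h.apply_J_self]; ring

lemma modelPsi_apply (h : IsHermitianPair G J) (ξ X : E) :
    modelPsi G J ξ X (J X) (J X) X = (G ξ X ^ 2 + G (J ξ) X ^ 2) ^ 2 := by
  simp only [modelPsi, h.apply_J, h.sq, map_neg, neg_apply]; ring

lemma nonneg (h : IsHermitianPair G J) (v : E) : 0 ≤ G v v := by
  rcases eq_or_ne v 0 with rfl | hv
  · simp
  · exact (h.pos v hv).le

/-- Bessel's inequality for the orthonormal pair `ξ, Jξ`. -/
lemma sq_add_sq_le (h : IsHermitianPair G J) {ξ X : E} (hξ : G ξ ξ = 1) (hX : G X X = 1) :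
    G ξ X ^ 2 + G (J ξ) X ^ 2 ≤ 1 := by
  have h1 := h.nonneg (X - G ξ X • ξ - G (J ξ) X • J ξ)
  simp only [map_sub, map_smul, sub_apply, smul_apply, smul_eq_mul, h.hermitian, h.apply_J,
    h.apply_J_self, hξ, hX, h.symm X, h.apply_J_comm X ξ] at h1
  linarith

end IsHermitianPair

/-- A function of the angle which gives the holomorphic sectional curvatures of a Kähler curvature
tensor is a polynomial `a + b t + c t²` in the squared cosine `t`: evaluate it on the unit vectors
`√(1 - t) u ± √t ξ`. -/
lemma IsKahlerTensor.exists_coefficients {G : E →L[ℝ] E →L[ℝ] ℝ} {J : E →L[ℝ] E}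
    {T : E → E → E → E → ℝ} (hT : IsKahlerTensor J T) (h : IsHermitianPair G J) {ξ u : E}
    (hξ : G ξ ξ = 1) (hu : G u u = 1) (hξu : G ξ u = 0) (hJξu : G (J ξ) u = 0) (f : ℝ → ℝ)
    (hf : ∀ X, G X X = 1 →
      T X (J X) (J X) X = f (Real.arccos (√(G ξ X ^ 2 + G (J ξ) X ^ 2)))) :
    ∃ a b c : ℝ, ∀ t, 0 ≤ t → t ≤ 1 → f (Real.arccos √t) = a + b * t + c * t ^ 2 := by
  refine ⟨T u (J u) (J u) u, IsKahlerTensor.mixedTerm J T u ξ - 2 * T u (J u) (J u) u,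
    T u (J u) (J u) u - IsKahlerTensor.mixedTerm J T u ξ + T ξ (J ξ) (J ξ) ξ, fun t h0 h1 => ?_⟩
  have ha : √(1 - t) ^ 2 = 1 - t := Real.sq_sqrt (by linarith)
  have hb : √t ^ 2 = t := Real.sq_sqrt h0
  have huξ : G u ξ = 0 := by rw [h.symm, hξu]
  have key : ∀ b : ℝ, b ^ 2 = t → T (√(1 - t) • u + b • ξ) (J (√(1 - t) • u + b • ξ))
      (J (√(1 - t) • u + b • ξ)) (√(1 - t) • u + b • ξ) = f (Real.arccos √t) := by
    intro b hb
    rw [hf]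
    · simp [hξu, hJξu, hξ, h.apply_J_self, hb]
    · simp only [map_add, map_smul, add_apply, smul_apply, smul_eq_mul, hu, hξ, hξu, huξ]
      linear_combination ha + hb
  have hs := hT.apply_add_sub (√(1 - t)) (√t) u ξ
  rw [key _ hb, key _ (by rw [neg_sq, hb])] at hs
  have ha4 : √(1 - t) ^ 4 = (1 - t) ^ 2 := by nth_rw 2 [← ha]; exact pow_mul _ 2 2
  have hb4 : √t ^ 4 = t ^ 2 := by nth_rw 2 [← hb]; exact pow_mul _ 2 2
  rw [ha, hb, ha4, hb4] at hs
  linear_combination hs / 2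

/-- A Kähler curvature tensor whose holomorphic sectional curvature is `a + b t + c t²`, with
`t` the squared length of the projection to `span {ξ, Jξ}`, is `a π + b Φ + c Ψ`. -/
lemma IsKahlerTensor.eq_model {G : E →L[ℝ] E →L[ℝ] ℝ} {J : E →L[ℝ] E}
    {T : E → E → E → E → ℝ} (hT : IsKahlerTensor J T) (h : IsHermitianPair G J) {ξ : E}
    {a b c : ℝ}
    (hf : ∀ X, G X X = 1 → T X (J X) (J X) X = a + b * (G ξ X ^ 2 + G (J ξ) X ^ 2)
      + c * (G ξ X ^ 2 + G (J ξ) X ^ 2) ^ 2) (X Y Z U : E) :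
    T X Y Z U = a * modelPi G J X Y Z U + b * modelPhi G J ξ X Y Z U
      + c * modelPsi G J ξ X Y Z U := by
  have hd := hT.add ((((h.isKahlerTensor_modelPi.smul (-a)).add
    ((h.isKahlerTensor_modelPhi ξ).smul (-b))).add ((h.isKahlerTensor_modelPsi ξ).smul (-c))))
  have hz := hd.eq_zero h.sq (fun x => ?_) X Y Z U
  · linarith
  by_cases hx : x = 0
  · subst hx
    simpa using hd.apply_smul 0 0
  have hp : 0 < √(G x x) := Real.sqrt_pos.2 (h.pos x hx)
  have hp2 : √(G x x) ^ 2 = G x x := Real.sq_sqrt (h.pos x hx).le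
  have hr : x = √(G x x) • ((√(G x x))⁻¹ • x) := by rw [smul_inv_smul₀ hp.ne']
  have hunit : G ((√(G x x))⁻¹ • x) ((√(G x x))⁻¹ • x) = 1 := by
    simp only [map_smul, smul_apply, smul_eq_mul]
    field_simp
    exact hp2.symm
  rw [hr]
  refine (hd.apply_smul _ _).trans ?_
  rw [hf _ hunit, h.modelPi_apply, h.modelPhi_apply, h.modelPsi_apply, hunit]
  ring

end KahlerTensor

/-! ### An inequality for cubic forms -/

section CubicForm

/-- The coefficient of the squared trace in the Ricci inequality. -/
def meanCoefficient (n : ℝ) : ℝ := (3 * n - 1) * (n - 2) / (2 * (3 * n + 5))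

lemma meanCoefficient_pos {n : ℝ} (hn : 3 ≤ n) : 0 < meanCoefficient n :=
  div_pos (mul_pos (by linarith) (by linarith)) (by linarith)

/-- The inequality that determines the constant `meanCoefficient n`: for `Q = S² / (n - 2)` the
form in `x, y, S` is degenerate, with kernel spanned by `(x, y, S) = (2, 9, 3 (n - 2))`, so no
smaller constant would do. -/
lemma quadratic_nonneg {n x y S Q : ℝ} (hn : 3 ≤ n) (hQ : S ^ 2 ≤ (n - 2) * Q) :
    0 ≤ meanCoefficient n * (x + y + S) ^ 2 - (n - 1) / 2 * (x + y + S) ^ 2 + x * (x + y + S)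
      + ((n - 3) / 2 + (n - 2)) * x ^ 2 + (n - 1) / 2 * y ^ 2 + 3 * (n - 1) / 2 * Q := by
  have hC := meanCoefficient_pos hn
  have h2 : n - 2 ≠ 0 := by linarith
  have h5 : 3 * n + 5 ≠ 0 := by linarith
  have hQ' : S ^ 2 / (n - 2) ≤ Q := by rw [div_le_iff₀ (by linarith)]; linarith
  -- Completing the square in `y`, whose coefficient is `meanCoefficient n`, leaves a multiple of a
  -- single square, since the form has a kernel.
  have hid : meanCoefficient n * (meanCoefficient n * (x + y + S) ^ 2
      - (n - 1) / 2 * (x + y + S) ^ 2 + x * (x + y + S)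
      + ((n - 3) / 2 + (n - 2)) * x ^ 2 + (n - 1) / 2 * y ^ 2
      + 3 * (n - 1) / 2 * (S ^ 2 / (n - 2)))
    = (meanCoefficient n * y + (meanCoefficient n - (n - 2) / 2) * x
        + (meanCoefficient n - (n - 1) / 2) * S) ^ 2
      + (n - 1) / (4 * (3 * n + 5)) * (3 * (n - 2) * x - 2 * S) ^ 2 := by
    rw [meanCoefficient]
    field_simp
    ring
  have h0 : 0 ≤ (n - 1) / (4 * (3 * n + 5)) := div_nonneg (by linarith) (by linarith)
  have h1 := nonneg_of_mul_nonneg_right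
    (hid ▸ add_nonneg (sq_nonneg _) (mul_nonneg h0 (sq_nonneg _))) hC
  have h3 := mul_le_mul_of_nonneg_left hQ' (show 0 ≤ 3 * (n - 1) / 2 by linarith)
  linarith

/-- The counterpart of `quadratic_nonneg` for the normal direction `J X`: this form is definite. -/
lemma quadratic_self {n x S Q : ℝ} (hn : 3 ≤ n) (hQ : S ^ 2 ≤ (n - 1) * Q) :
    0 ≤ meanCoefficient n * (x + S) ^ 2 - (n - 1) / 2 * (x + S) ^ 2 + x * (x + S)
        + (n - 3) / 2 * x ^ 2 + (3 * n - 5) / 2 * Q ∧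
      (meanCoefficient n * (x + S) ^ 2 - (n - 1) / 2 * (x + S) ^ 2 + x * (x + S)
        + (n - 3) / 2 * x ^ 2 + (3 * n - 5) / 2 * Q = 0 → x = 0 ∧ Q = 0) := by
  have hC := meanCoefficient_pos hn
  have h1 : n - 1 ≠ 0 := by linarith
  have h2 : n - 2 ≠ 0 := by linarith
  have h5 : 3 * n + 5 ≠ 0 := by linarith
  have hQ' : S ^ 2 / (n - 1) ≤ Q := by rw [div_le_iff₀ (by linarith)]; linarith
  set A := meanCoefficient n * x + (meanCoefficient n - (n - 2) / 2) * S with hA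
  have hid : meanCoefficient n * (meanCoefficient n * (x + S) ^ 2 - (n - 1) / 2 * (x + S) ^ 2
      + x * (x + S) + (n - 3) / 2 * x ^ 2 + (3 * n - 5) / 2 * (S ^ 2 / (n - 1)))
    = A ^ 2 + (n - 2) ^ 2 / ((3 * n + 5) * (n - 1)) * S ^ 2 := by
    rw [hA, meanCoefficient]
    field_simp
    ring
  set P := meanCoefficient n * (x + S) ^ 2 - (n - 1) / 2 * (x + S) ^ 2
      + x * (x + S) + (n - 3) / 2 * x ^ 2 + (3 * n - 5) / 2 * (S ^ 2 / (n - 1)) with hP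
  have hd : 0 < (n - 2) ^ 2 / ((3 * n + 5) * (n - 1)) :=
    div_pos (by positivity) (mul_pos (by linarith) (by linarith))
  have hP0 : 0 ≤ P := nonneg_of_mul_nonneg_right
    (hid ▸ add_nonneg (sq_nonneg _) (mul_nonneg hd.le (sq_nonneg _))) hC
  have hc : 0 < (3 * n - 5) / 2 := by linarith
  have h3 := mul_le_mul_of_nonneg_left hQ' hc.le
  refine ⟨by linarith, fun h0 => ?_⟩
  have hP1 : P = 0 := by linarith
  rw [hP1, mul_zero] at hid
  have hS2 : (n - 2) ^ 2 / ((3 * n + 5) * (n - 1)) * S ^ 2 = 0 :=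
    le_antisymm (by linarith [sq_nonneg A]) (mul_nonneg hd.le (sq_nonneg _))
  have hS : S = 0 := by simpa [hd.ne'] using hS2
  have hx : x = 0 := by
    have : A = 0 := by
      have : A ^ 2 = 0 := by rw [hS2] at hid; linarith
      simpa using this
    rw [hA, hS, mul_zero, add_zero] at this
    exact (mul_eq_zero.1 this).resolve_left hC.ne'
  refine ⟨hx, ?_⟩
  rw [hS, hx] at h0
  have : (3 * n - 5) / 2 * Q = 0 := by linarith
  exact (mul_eq_zero.1 this).resolve_left hc.ne'

variable {n : ℕ}

/-- The weight of `c i j r ^ 2` in the Ricci inequality in the direction of the `k`-th vector. -/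
def pairWeight (k i j : Fin n) : ℝ :=
  ((n : ℝ) - 1) / 2 - ((if i = k then 1 else 0) + (if j = k then 1 else 0)) / 2

lemma pairWeight_comm (k i j : Fin n) : pairWeight k i j = pairWeight k j i := by
  rw [pairWeight, pairWeight, add_comm (ite _ _ _)]

/-- The part of the Ricci inequality in the direction of the `k`-th vector which involves the
components `x i = c i i r` of a cubic form, for a fixed `r`. -/
def diagonalForm (k r : Fin n) (x : Fin n → ℝ) : ℝ :=
  meanCoefficient n * (∑ i, x i) ^ 2 - ((n : ℝ) - 1) / 2 * (∑ i, x i) ^ 2 + x k * ∑ i, x i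
    + ∑ i, pairWeight k i i * x i ^ 2
    + 2 * ∑ i, if i = r then 0 else pairWeight k i r * x i ^ 2

/-- Separating `x k` and `x r` from the other `x i`, which enter only through their sum and the sum
of their squares, reduces the claim to `quadratic_nonneg`. -/
lemma diagonalForm_nonneg_of_ne (hn : 3 ≤ n) {k r : Fin n} (hkr : r ≠ k) (x : Fin n → ℝ) :
    0 ≤ diagonalForm k r x := by
  have hn' : (3 : ℝ) ≤ n := by exact_mod_cast hn
  have split : ∀ f : Fin n → ℝ, ∑ i, f i
      = f k + f r + ∑ i ∈ (Finset.univ.erase k).erase r, f i := by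
    intro f
    rw [← Finset.add_sum_erase _ f (Finset.mem_univ k),
      ← Finset.add_sum_erase (Finset.univ.erase k) f (Finset.mem_erase.2 ⟨hkr, Finset.mem_univ r⟩)]
    ring
  have hcard : (((Finset.univ.erase k).erase r).card : ℝ) = n - 2 := by
    rw [Finset.card_erase_of_mem (Finset.mem_erase.2 ⟨hkr, Finset.mem_univ r⟩),
      Finset.card_erase_of_mem (Finset.mem_univ k), Finset.card_univ, Fintype.card_fin]
    have : n - 1 - 1 = n - 2 := by omega
    rw [this, Nat.cast_sub (by omega)]
    norm_num
  have hQ := sq_sum_le_card_mul_sum_sq (s := (Finset.univ.erase k).erase r) (f := x)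
  rw [hcard] at hQ
  have key := quadratic_nonneg (x := x k) (y := x r) hn' hQ
  have e1 : ∑ i ∈ (Finset.univ.erase k).erase r, pairWeight k i i * x i ^ 2
      = ((n : ℝ) - 1) / 2 * ∑ i ∈ (Finset.univ.erase k).erase r, x i ^ 2 := by
    rw [Finset.mul_sum]
    refine Finset.sum_congr rfl fun i hi => ?_
    simp only [Finset.mem_erase] at hi
    simp [pairWeight, hi.2.1]
  have e2 : (∑ i ∈ (Finset.univ.erase k).erase r, if i = r then 0 else pairWeight k i r * x i ^ 2)
      = ((n : ℝ) - 1) / 2 * ∑ i ∈ (Finset.univ.erase k).erase r, x i ^ 2 := by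
    rw [Finset.mul_sum]
    refine Finset.sum_congr rfl fun i hi => ?_
    simp only [Finset.mem_erase] at hi
    simp [pairWeight, hi.1, hi.2.1, hkr]
  refine key.trans_eq ?_
  rw [diagonalForm, split x, split (fun i => pairWeight k i i * x i ^ 2),
    split (fun i => if i = r then 0 else pairWeight k i r * x i ^ 2), e1, e2]
  simp only [pairWeight, hkr, hkr.symm, if_true, if_false]
  ring

/-- For `r = k` only `x k` is distinguished, and `quadratic_self` applies. -/
lemma diagonalForm_self (hn : 3 ≤ n) (k : Fin n) (x : Fin n → ℝ) :
    0 ≤ diagonalForm k k x ∧ (diagonalForm k k x = 0 → ∀ i, x i = 0) := by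
  have hn' : (3 : ℝ) ≤ n := by exact_mod_cast hn
  have split : ∀ f : Fin n → ℝ, ∑ i, f i = f k + ∑ i ∈ Finset.univ.erase k, f i :=
    fun f => (Finset.add_sum_erase _ f (Finset.mem_univ k)).symm
  have hcard : ((Finset.univ.erase k).card : ℝ) = n - 1 := by
    rw [Finset.card_erase_of_mem (Finset.mem_univ k), Finset.card_univ, Fintype.card_fin,
      Nat.cast_sub (by omega)]
    norm_num
  have hQ := sq_sum_le_card_mul_sum_sq (s := Finset.univ.erase k) (f := x)
  rw [hcard] at hQ
  have key := quadratic_self (x := x k) hn' hQ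
  have e1 : ∑ i ∈ Finset.univ.erase k, pairWeight k i i * x i ^ 2
      = ((n : ℝ) - 1) / 2 * ∑ i ∈ Finset.univ.erase k, x i ^ 2 := by
    rw [Finset.mul_sum]
    refine Finset.sum_congr rfl fun i hi => ?_
    simp only [Finset.mem_erase] at hi
    simp [pairWeight, hi.1]
  have e2 : (∑ i ∈ Finset.univ.erase k, if i = k then 0 else pairWeight k i k * x i ^ 2)
      = ((n : ℝ) - 2) / 2 * ∑ i ∈ Finset.univ.erase k, x i ^ 2 := by
    rw [Finset.mul_sum]
    refine Finset.sum_congr rfl fun i hi => ?_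
    simp only [Finset.mem_erase] at hi
    simp only [pairWeight, hi.1, if_true, if_false]
    ring
  have heq : diagonalForm k k x = meanCoefficient n * (x k + ∑ i ∈ Finset.univ.erase k, x i) ^ 2
      - ((n : ℝ) - 1) / 2 * (x k + ∑ i ∈ Finset.univ.erase k, x i) ^ 2
      + x k * (x k + ∑ i ∈ Finset.univ.erase k, x i)
      + ((n : ℝ) - 3) / 2 * x k ^ 2
      + (3 * (n : ℝ) - 5) / 2 * ∑ i ∈ Finset.univ.erase k, x i ^ 2 := by
    rw [diagonalForm, split x, split (fun i => pairWeight k i i * x i ^ 2),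
      split (fun i => if i = k then 0 else pairWeight k i k * x i ^ 2), e1, e2]
    simp only [pairWeight, if_true]
    ring
  rw [heq]
  refine ⟨key.1, fun h0 i => ?_⟩
  obtain ⟨hk, hq⟩ := key.2 h0
  by_cases hi : i = k
  · rw [hi, hk]
  · rw [Finset.sum_eq_zero_iff_of_nonneg fun i _ => sq_nonneg _] at hq
    simpa using hq i (Finset.mem_erase.2 ⟨hi, Finset.mem_univ i⟩)

/-- For the components `c i j r` of a second fundamental form with values in a Euclidean space, the
difference of the two sides of the Ricci inequality in the direction of the `k`-th vector. -/
def ricciDefect (c : Fin n → Fin n → Fin n → ℝ) (k : Fin n) : ℝ :=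
  meanCoefficient n * ∑ r, (∑ i, c i i r) ^ 2
    - ((n : ℝ) - 1) / 2 * ∑ r, ((∑ i, c i i r) ^ 2 - ∑ i, ∑ j, c i j r ^ 2)
    + ∑ r, (c k k r * ∑ i, c i i r - ∑ i, c k i r ^ 2)

variable {c : Fin n → Fin n → Fin n → ℝ}

/-- For a totally symmetric `c`, the squares `c i j r ^ 2` split into those of the components
`c i i r` and those with `i, j, r` distinct. -/
lemma sum_pairWeight_mul_sq (h12 : ∀ i j r, c i j r = c j i r) (h23 : ∀ i j r, c i j r = c i r j)
    (k : Fin n) :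
    ∑ r, ∑ i, ∑ j, pairWeight k i j * c i j r ^ 2
      = (∑ r, ∑ i, pairWeight k i i * c i i r ^ 2)
        + 2 * (∑ r, ∑ i, if i = r then 0 else pairWeight k i r * c i i r ^ 2)
        + ∑ r, ∑ i, ∑ j, if i ≠ j ∧ r ≠ i ∧ r ≠ j then pairWeight k i j * c i j r ^ 2 else 0 := by
  have hpt : ∀ i j r : Fin n, pairWeight k i j * c i j r ^ 2
      = (if j = i then pairWeight k i j * c i j r ^ 2 else 0)
        + (if i = r then (if j = i then 0 else pairWeight k i j * c i j r ^ 2) else 0)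
        + (if j = r then (if i = j then 0 else pairWeight k i j * c i j r ^ 2) else 0)
        + (if i ≠ j ∧ r ≠ i ∧ r ≠ j then pairWeight k i j * c i j r ^ 2 else 0) := by
    intro i j r
    by_cases h1 : i = j
    · subst h1; simp
    · by_cases h2 : i = r
      · subst h2; simp [h1, Ne.symm h1]
      · by_cases h3 : j = r
        · subst h3; simp [h1, Ne.symm h1]
        · simp [h1, h2, h3, Ne.symm h1, Ne.symm h2, Ne.symm h3]
  have s2 : (∑ r, ∑ i, ∑ j,
      if i = r then (if j = i then 0 else pairWeight k i j * c i j r ^ 2) else 0)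
      = ∑ r, ∑ i, if i = r then 0 else pairWeight k i r * c i i r ^ 2 := by
    rw [Finset.sum_comm]
    conv_rhs => rw [Finset.sum_comm]
    refine Finset.sum_congr rfl fun i _ => ?_
    rw [Finset.sum_comm]
    refine Finset.sum_congr rfl fun j _ => ?_
    rw [Finset.sum_ite_eq Finset.univ i, if_pos (Finset.mem_univ i), h23 i j i]
    simp only [eq_comm]
  have s3 : (∑ r, ∑ i, ∑ j,
      if j = r then (if i = j then 0 else pairWeight k i j * c i j r ^ 2) else 0)
      = ∑ r, ∑ i, if i = r then 0 else pairWeight k i r * c i i r ^ 2 := by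
    rw [Finset.sum_comm]
    refine Finset.sum_congr rfl fun i _ => Finset.sum_congr rfl fun r _ => ?_
    rw [Finset.sum_ite_eq' Finset.univ r, if_pos (Finset.mem_univ r), pairWeight_comm, h12 i r,
      h23 r i r]
    simp only [eq_comm]
  rw [Finset.sum_congr rfl fun r _ => Finset.sum_congr rfl fun i _ =>
    Finset.sum_congr rfl fun j _ => hpt i j r]
  simp only [Finset.sum_add_distrib]
  rw [s2, s3]
  simp only [Finset.sum_ite_eq', Finset.mem_univ, if_true]
  ring

/-- For a totally symmetric `c`, the defect is a sum over `r` of forms in `c i i r` alone, plus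
nonnegative multiples of the squares of the components with distinct indices. -/
lemma ricciDefect_eq (h12 : ∀ i j r, c i j r = c j i r) (h23 : ∀ i j r, c i j r = c i r j)
    (k : Fin n) :
    ricciDefect c k = (∑ r, diagonalForm k r fun i => c i i r)
      + ∑ r, ∑ i, ∑ j, if i ≠ j ∧ r ≠ i ∧ r ≠ j then pairWeight k i j * c i j r ^ 2 else 0 := by
  have hw : ∀ r, ∑ i, ∑ j, pairWeight k i j * c i j r ^ 2
      = ((n : ℝ) - 1) / 2 * (∑ i, ∑ j, c i j r ^ 2) - ∑ i, c k i r ^ 2 := by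
    intro r
    have e1 : (∑ i, ∑ j, if i = k then c i j r ^ 2 else 0) = ∑ i, c k i r ^ 2 := by
      rw [Finset.sum_comm]
      simp
    have e2 : (∑ i, ∑ j, if j = k then c i j r ^ 2 else 0) = ∑ i, c k i r ^ 2 := by
      simp [h12 _ k r]
    have e3 : ∀ i j, pairWeight k i j * c i j r ^ 2 = ((n : ℝ) - 1) / 2 * c i j r ^ 2
        - 1 / 2 * (if i = k then c i j r ^ 2 else 0)
        - 1 / 2 * (if j = k then c i j r ^ 2 else 0) := fun i j => by
      rw [pairWeight]; split_ifs <;> ring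
    simp only [e3, Finset.sum_sub_distrib, ← Finset.mul_sum]
    rw [e1, e2]
    ring
  have hs := sum_pairWeight_mul_sq h12 h23 k
  rw [Finset.sum_congr rfl fun r _ => hw r] at hs
  simp only [ricciDefect, diagonalForm, Finset.sum_add_distrib, Finset.sum_sub_distrib,
    ← Finset.mul_sum] at hs ⊢
  linarith

lemma pairWeight_pos (hn : 3 ≤ n) (k : Fin n) {i j : Fin n} (hij : i ≠ j) :
    0 < pairWeight k i j := by
  have hn' : (3 : ℝ) ≤ n := by exact_mod_cast hn
  rw [pairWeight]
  by_cases h1 : i = k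
  · have h2 : ¬j = k := fun h => hij (h1.trans h.symm)
    rw [if_pos h1, if_neg h2]; linarith
  · rw [if_neg h1]; split_ifs <;> linarith

lemma offDiagonal_nonneg (hn : 3 ≤ n) (k i j r : Fin n) :
    0 ≤ if i ≠ j ∧ r ≠ i ∧ r ≠ j then pairWeight k i j * c i j r ^ 2 else 0 := by
  split_ifs with h
  · exact mul_nonneg (pairWeight_pos hn k h.1).le (sq_nonneg _)
  · exact le_rfl

lemma diagonalForm_nonneg (hn : 3 ≤ n) (k r : Fin n) (x : Fin n → ℝ) :
    0 ≤ diagonalForm k r x := by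
  by_cases h : r = k
  · rw [h]; exact (diagonalForm_self hn k x).1
  · exact diagonalForm_nonneg_of_ne hn h x

lemma ricciDefect_nonneg (hn : 3 ≤ n) (h12 : ∀ i j r, c i j r = c j i r)
    (h23 : ∀ i j r, c i j r = c i r j) (k : Fin n) : 0 ≤ ricciDefect c k := by
  rw [ricciDefect_eq h12 h23]
  exact add_nonneg (Finset.sum_nonneg fun r _ => diagonalForm_nonneg hn k r _)
    (Finset.sum_nonneg fun r _ => Finset.sum_nonneg fun i _ => Finset.sum_nonneg fun j _ =>
      offDiagonal_nonneg hn k i j r)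

lemma eq_zero_of_sum_sum_sum_eq_zero {f : Fin n → Fin n → Fin n → ℝ} (hf : ∀ i j r, 0 ≤ f i j r)
    (h : ∑ i, ∑ j, ∑ r, f i j r = 0) (i j r : Fin n) : f i j r = 0 := by
  rw [Finset.sum_eq_zero_iff_of_nonneg fun i _ => Finset.sum_nonneg fun j _ =>
    Finset.sum_nonneg fun r _ => hf i j r] at h
  have h1 := h i (Finset.mem_univ i)
  rw [Finset.sum_eq_zero_iff_of_nonneg fun j _ => Finset.sum_nonneg fun r _ => hf i j r] at h1
  have h2 := h1 j (Finset.mem_univ j)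
  rw [Finset.sum_eq_zero_iff_of_nonneg fun r _ => hf i j r] at h2
  exact h2 r (Finset.mem_univ r)

/-- The equality case in all directions: the direction `k` forces `c i i k = 0` and the vanishing of
the components with distinct indices. -/
lemma eq_zero_of_ricciDefect_eq_zero (hn : 3 ≤ n) (h12 : ∀ i j r, c i j r = c j i r)
    (h23 : ∀ i j r, c i j r = c i r j) (h0 : ∀ k, ricciDefect c k = 0) (i j r : Fin n) :
    c i j r = 0 := by
  have hparts : ∀ k, (∑ r, diagonalForm k r fun i => c i i r) = 0 ∧
      (∑ r, ∑ i, ∑ j, if i ≠ j ∧ r ≠ i ∧ r ≠ j then pairWeight k i j * c i j r ^ 2 else 0) = 0 := by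
    intro k
    have h1 : 0 ≤ ∑ r, diagonalForm k r fun i => c i i r :=
      Finset.sum_nonneg fun r _ => diagonalForm_nonneg hn k r _
    have h2 : 0 ≤ ∑ r, ∑ i, ∑ j,
        if i ≠ j ∧ r ≠ i ∧ r ≠ j then pairWeight k i j * c i j r ^ 2 else 0 :=
      Finset.sum_nonneg fun r _ => Finset.sum_nonneg fun i _ => Finset.sum_nonneg fun j _ =>
        offDiagonal_nonneg hn k i j r
    have h3 := h0 k
    rw [ricciDefect_eq h12 h23] at h3
    constructor <;> linarith
  have hdiag : ∀ i k, c i i k = 0 := by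
    intro i k
    have h1 := (Finset.sum_eq_zero_iff_of_nonneg
      fun r _ => diagonalForm_nonneg hn k r _).1 (hparts k).1 k (Finset.mem_univ k)
    exact (diagonalForm_self hn k _).2 h1 i
  by_cases hij : i = j
  · rw [hij, hdiag]
  by_cases hri : r = i
  · rw [hri, h23, hdiag]
  by_cases hrj : r = j
  · rw [hrj, h12, h23, hdiag]
  have h3 := eq_zero_of_sum_sum_sum_eq_zero
    (f := fun r i' j => if i' ≠ j ∧ r ≠ i' ∧ r ≠ j then pairWeight i i' j * c i' j r ^ 2 else 0)
    (fun r i' j => offDiagonal_nonneg hn i i' j r) (hparts i).2 r i j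
  simp only [if_pos (And.intro hij (And.intro hri hrj))] at h3
  simpa using (mul_eq_zero.1 h3).resolve_left (pairWeight_pos hn i hij).ne'

end CubicForm

/-! ### Orthonormal frames -/

section Frames

variable {E : Type*} [NormedAddCommGroup E] [NormedSpace ℝ E] [FiniteDimensional ℝ E]

/-- `b` is orthonormal for the bilinear form `G`. -/
def IsOrthonormalFamily {ι : Type*} [DecidableEq ι] (G : E →L[ℝ] E →L[ℝ] ℝ) (b : ι → E) : Prop :=
  ∀ i j, G (b i) (b j) = if i = j then 1 else 0

namespace IsOrthonormalFamily

variable {G : E →L[ℝ] E →L[ℝ] ℝ}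

lemma sum_smul {ι : Type*} [Fintype ι] [DecidableEq ι] {b : ι → E}
    (hb : IsOrthonormalFamily G b) (x : ι → ℝ) (j : ι) : G (b j) (∑ i, x i • b i) = x j := by
  simp only [map_sum, map_smul, hb j, smul_eq_mul, mul_ite, mul_one, mul_zero, Finset.sum_ite_eq,
    Finset.mem_univ, if_true]

lemma eq_sum {ι : Type*} [Fintype ι] [DecidableEq ι] {b : ι → E}
    (hb : IsOrthonormalFamily G b) (hcard : Fintype.card ι = finrank ℝ E) (v : E) :
    v = ∑ i, G (b i) v • b i := by
  have hli : LinearIndependent ℝ b := by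
    rw [Fintype.linearIndependent_iff]
    intro x hx j
    rw [← hb.sum_smul x j, hx, map_zero]
  have hv : v ∈ Submodule.span ℝ (Set.range b) := by
    rw [hli.span_eq_top_of_card_eq_finrank' hcard]; trivial
  obtain ⟨x, rfl⟩ := (Submodule.mem_span_range_iff_exists_fun ℝ).1 hv
  exact Finset.sum_congr rfl fun i _ => by rw [hb.sum_smul]

variable {n : ℕ} {e e' : Fin n → E}

/-- The trace of a bilinear map does not depend on the orthonormal basis. -/
lemma sum_apply_eq {V : Type*} [AddCommGroup V] [Module ℝ V] (hG : ∀ v w, G v w = G w v)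
    (he : IsOrthonormalFamily G e) (he' : IsOrthonormalFamily G e') (hn : finrank ℝ E = n)
    (B : E →ₗ[ℝ] E →ₗ[ℝ] V) : ∑ i, B (e i) (e i) = ∑ i, B (e' i) (e' i) := by
  have hcard : Fintype.card (Fin n) = finrank ℝ E := by rw [hn, Fintype.card_fin]
  calc ∑ j, B (e j) (e j) = ∑ j, B (e j) (∑ i, G (e' i) (e j) • e' i) :=
        Finset.sum_congr rfl fun j _ => by rw [← he'.eq_sum hcard]
    _ = ∑ i, B (∑ j, G (e j) (e' i) • e j) (e' i) := by
        simp only [map_sum, map_smul, LinearMap.sum_apply, LinearMap.smul_apply]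
        rw [Finset.sum_comm]
        exact Finset.sum_congr rfl fun i _ => Finset.sum_congr rfl fun j _ => by rw [hG]
    _ = ∑ i, B (e' i) (e' i) := Finset.sum_congr rfl fun i _ => by rw [← he.eq_sum hcard]

/-- A unit vector is the `k`-th member of an orthonormal frame: the frame `e` identifies the form
with the standard inner product of `EuclideanSpace ℝ (Fin n)`. -/
lemma exists_apply_eq (hG : ∀ v w, G v w = G w v) (he : IsOrthonormalFamily G e)
    (hn : finrank ℝ E = n) {X : E} (hX : G X X = 1) (k : Fin n) :
    ∃ e' : Fin n → E, IsOrthonormalFamily G e' ∧ e' k = X := by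
  have hcard : Fintype.card (Fin n) = finrank ℝ E := by rw [hn, Fintype.card_fin]
  have hinner : ∀ x y : EuclideanSpace ℝ (Fin n),
      G (∑ j, x j • e j) (∑ j, y j • e j) = inner ℝ x y := by
    intro x y
    rw [hG, map_sum, PiLp.inner_apply]
    refine Finset.sum_congr rfl fun j _ => ?_
    rw [map_smul, hG, he.sum_smul]
    simp [mul_comm]
  let x : EuclideanSpace ℝ (Fin n) := WithLp.toLp 2 fun j => G (e j) X
  have hxX : ∑ j, x j • e j = X := (he.eq_sum hcard X).symm
  have hx : ‖x‖ = 1 := by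
    have := hinner x x
    rw [hxX, hX, real_inner_self_eq_norm_sq] at this
    nlinarith [norm_nonneg x]
  have hv : Orthonormal ℝ (Set.domRestrict {k} fun _ : Fin n => x) :=
    ⟨fun _ => hx, fun i j hij => (hij (Subsingleton.elim i j)).elim⟩
  obtain ⟨b, hb⟩ := hv.exists_orthonormalBasis_extension_of_card_eq (by simp)
  refine ⟨fun i => ∑ j, b i j • e j, fun i l => ?_, ?_⟩
  · rw [hinner, orthonormal_iff_ite.1 b.orthonormal]
  · simpa only [hb k rfl] using hxX

end IsOrthonormalFamily

lemma sum_Ioi_eq_half_sum {n : ℕ} {s : Fin n → Fin n → ℝ} (hs : ∀ i j, s i j = s j i)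
    (h0 : ∀ i, s i i = 0) : ∑ i, ∑ j ∈ Finset.Ioi i, s i j = (∑ i, ∑ j, s i j) / 2 := by
  have h1 : ∀ i, ∑ j, s i j = ∑ j ∈ Finset.Ioi i, s i j + ∑ j ∈ Finset.Iio i, s i j := by
    intro i
    have hI : (Finset.univ : Finset (Fin n)) = (Finset.Ioi i ∪ Finset.Iio i) ∪ {i} := by
      ext j
      simp only [Finset.mem_univ, Finset.mem_union, Finset.mem_Ioi, Finset.mem_Iio,
        Finset.mem_singleton, true_iff]
      rcases lt_trichotomy i j with h | h | h
      · exact Or.inl (Or.inl h)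
      · exact Or.inr h.symm
      · exact Or.inl (Or.inr h)
    rw [hI, Finset.sum_union, Finset.sum_union, Finset.sum_singleton, h0, add_zero]
    · rw [Finset.disjoint_left]
      intro j hj hj'
      exact lt_asymm (Finset.mem_Ioi.1 hj) (Finset.mem_Iio.1 hj')
    · simp
  have h2 : ∑ i, ∑ j ∈ Finset.Iio i, s i j = ∑ i, ∑ j ∈ Finset.Ioi i, s i j := by
    rw [Finset.sum_comm' (t' := Finset.univ) (s' := fun j => Finset.Ioi j) (by simp)]
    exact Finset.sum_congr rfl fun i _ => Finset.sum_congr rfl fun j _ => hs j i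
  rw [Finset.sum_congr rfl fun i _ => h1 i, Finset.sum_add_distrib, h2]
  ring

end Frames

/-! ### The Ricci inequality at a point -/

section LagrangianPoint

variable {E : Type*} [NormedAddCommGroup E] [NormedSpace ℝ E] [FiniteDimensional ℝ E]
  {F : Type*} [NormedAddCommGroup F] [NormedSpace ℝ F] [FiniteDimensional ℝ F]

/-- The linear algebra at a point of a Lagrangian submanifold: `A` is the differential of the
immersion, `h` the second fundamental form, `γ` the induced metric, `T` and `R` the curvature
tensors of the ambient space and of the submanifold. -/
structure IsLagrangianPoint (G : E →L[ℝ] E →L[ℝ] ℝ) (J : E →L[ℝ] E) (A : F →L[ℝ] E)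
    (γ : F →L[ℝ] F →L[ℝ] ℝ) (h : F → F → E) (T : E → E → E → E → ℝ)
    (R : F → F → F → F → ℝ) : Prop where
  hermitian : IsHermitianPair G J
  induced : ∀ u v, γ u v = G (A u) (A v)
  finrank_eq : finrank ℝ E = 2 * finrank ℝ F
  totally_real : ∀ u v, G (J (A u)) (A v) = 0
  add_left : ∀ u u' v, h (u + u') v = h u v + h u' v
  smul_left : ∀ (r : ℝ) u v, h (r • u) v = r • h u v
  symm : ∀ u v, h u v = h v u
  normal : ∀ u v w, G (h u v) (A w) = 0
  comm : ∀ u v w, G (J (h u v)) (A w) + G (J (A v)) (h u w) = 0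
  isKahlerTensor : IsKahlerTensor J T
  gauss : ∀ u v w z, R u v w z = T (A u) (A v) (A w) (A z)
    + G (h v w) (h u z) - G (h u w) (h v z)

/-- The right-hand side of the Ricci inequality in terms of the linear algebra at a point. -/
def pointwiseLowerBound {n : ℕ} (G : E →L[ℝ] E →L[ℝ] ℝ) (J : E →L[ℝ] E) (A : F →L[ℝ] E)
    (γ : F →L[ℝ] F →L[ℝ] ℝ) (h : F → F → E) (R : F → F → F → F → ℝ) (a b c : ℝ) (ξ : E)
    (e : Fin n → F) (X : F) : ℝ :=
  let T := ∑ i, G ξ (A (e i)) • e i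
  let T' := ∑ i, G (J ξ) (A (e i)) • e i
  let W := G ξ (A X) • T' - G (J ξ) (A X) • T
  let H := (1 / n : ℝ) • ∑ i, h (e i) (e i)
  ((n : ℝ) - 2) * (n - 1) * (n + 1) / 8 * (-a)
    - ((n : ℝ) - 2) / 8 * (n - (G ξ (A X) ^ 2 + G (J ξ) (A X) ^ 2)) * b
    - (((n : ℝ) - 1) * (γ T T * γ T' T' - γ T T' ^ 2) - γ W W) * c
    + ((n : ℝ) - 1) * (∑ i, ∑ j ∈ Finset.Ioi i, R (e i) (e j) (e j) (e i))
    - (3 * (n : ℝ) - 1) * (n - 2) * (n : ℝ) ^ 2 / (2 * (3 * n + 5)) * G H H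

/-- The components of the second fundamental form with respect to the orthonormal frame
`J A e_r` of the normal space. -/
def sffComponents {n : ℕ} (G : E →L[ℝ] E →L[ℝ] ℝ) (J : E →L[ℝ] E) (A : F →L[ℝ] E) (h : F → F → E)
    (e : Fin n → F) (i j r : Fin n) : ℝ :=
  G (h (e i) (e j)) (J (A (e r)))

namespace IsLagrangianPoint

variable {G : E →L[ℝ] E →L[ℝ] ℝ} {J : E →L[ℝ] E} {A : F →L[ℝ] E} {γ : F →L[ℝ] F →L[ℝ] ℝ}
  {h : F → F → E} {T : E → E → E → E → ℝ} {R : F → F → F → F → ℝ} {n : ℕ} {e e' : Fin n → F}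

lemma add_right (hL : IsLagrangianPoint G J A γ h T R) (u v v' : F) :
    h u (v + v') = h u v + h u v' := by
  rw [hL.symm, hL.add_left, hL.symm v, hL.symm v']

lemma smul_right (hL : IsLagrangianPoint G J A γ h T R) (r : ℝ) (u v : F) :
    h u (r • v) = r • h u v := by
  rw [hL.symm, hL.smul_left, hL.symm v]

lemma induced_symm (hL : IsLagrangianPoint G J A γ h T R) (u v : F) : γ u v = γ v u := by
  rw [hL.induced, hL.induced, hL.hermitian.symm]

/-- The curvature of the submanifold as a bilinear map in the middle arguments. -/
lemma exists_bilinear_mid (hL : IsLagrangianPoint G J A γ h T R) (u z : F) :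
    ∃ B : F →ₗ[ℝ] F →ₗ[ℝ] ℝ, ∀ v w, B v w = R u v w z := by
  have hT := hL.isKahlerTensor
  refine ⟨LinearMap.mk₂ ℝ (fun v w => R u v w z) ?_ ?_ ?_ ?_, fun v w => rfl⟩
  · intro v v' w
    simp only [hL.gauss, map_add, hT.add_2, hL.add_left, add_apply]; ring
  · intro r v w
    simp only [hL.gauss, map_smul, hT.smul_2, hL.smul_left, smul_apply, smul_eq_mul]; ring
  · intro v w w'
    simp only [hL.gauss, map_add, hT.add_3, hL.add_right, add_apply]; ring
  · intro r v w
    simp only [hL.gauss, map_smul, hT.smul_3, hL.smul_right, smul_apply, smul_eq_mul]; ring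

/-- The curvature of the submanifold as a bilinear map in the outer arguments. -/
lemma exists_bilinear_outer (hL : IsLagrangianPoint G J A γ h T R) (v w : F) :
    ∃ B : F →ₗ[ℝ] F →ₗ[ℝ] ℝ, ∀ u z, B u z = R u v w z := by
  have hT := hL.isKahlerTensor
  refine ⟨LinearMap.mk₂ ℝ (fun u z => R u v w z) ?_ ?_ ?_ ?_, fun v w => rfl⟩
  · intro u u' z
    simp only [hL.gauss, map_add, hT.add_left, hL.add_left, add_apply]; ring
  · intro r u z
    simp only [hL.gauss, map_smul, hT.smul_left, hL.smul_left, smul_apply, smul_eq_mul]; ring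
  · intro u z z'
    simp only [hL.gauss, map_add, hT.add_4, hL.add_right]; ring
  · intro r u z
    simp only [hL.gauss, map_smul, hT.smul_4, hL.smul_right, smul_eq_mul]; ring

lemma sum_ricci_eq (hL : IsLagrangianPoint G J A γ h T R) (hn : finrank ℝ F = n)
    (he : IsOrthonormalFamily γ e) (he' : IsOrthonormalFamily γ e') (X : F) :
    ∑ i, R X (e i) (e i) X = ∑ i, R X (e' i) (e' i) X := by
  obtain ⟨B, hB⟩ := hL.exists_bilinear_mid X X
  simpa only [hB] using IsOrthonormalFamily.sum_apply_eq hL.induced_symm he he' hn B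

lemma scalar_eq_half_sum (hL : IsLagrangianPoint G J A γ h T R) (e : Fin n → F) :
    ∑ i, ∑ j ∈ Finset.Ioi i, R (e i) (e j) (e j) (e i)
      = (∑ i, ∑ j, R (e i) (e j) (e j) (e i)) / 2 := by
  have hT := hL.isKahlerTensor
  refine sum_Ioi_eq_half_sum (fun i j => ?_) fun i => ?_
  · rw [hL.gauss, hL.gauss, hT.swap_left, hT.swap_right, hL.hermitian.symm (h (e j) (e j)),
      hL.symm (e i) (e j)]
    ring
  · have := hT.swap_left (A (e i)) (A (e i)) (A (e i)) (A (e i))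
    rw [hL.gauss]
    linarith

lemma sum_scalar_eq (hL : IsLagrangianPoint G J A γ h T R) (hn : finrank ℝ F = n)
    (he : IsOrthonormalFamily γ e) (he' : IsOrthonormalFamily γ e') :
    ∑ i, ∑ j, R (e i) (e j) (e j) (e i) = ∑ i, ∑ j, R (e' i) (e' j) (e' j) (e' i) := by
  rw [Finset.sum_congr rfl fun i _ => hL.sum_ricci_eq hn he he' (e i), Finset.sum_comm]
  conv_rhs => rw [Finset.sum_comm]
  refine Finset.sum_congr rfl fun j _ => ?_
  obtain ⟨B, hB⟩ := hL.exists_bilinear_outer (e' j) (e' j)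
  simpa only [hB] using IsOrthonormalFamily.sum_apply_eq hL.induced_symm he he' hn B

lemma sum_tangential_eq (hL : IsLagrangianPoint G J A γ h T R) (hn : finrank ℝ F = n)
    (he : IsOrthonormalFamily γ e) (he' : IsOrthonormalFamily γ e') (ζ : E) :
    ∑ i, G ζ (A (e i)) • e i = ∑ i, G ζ (A (e' i)) • e' i :=
  IsOrthonormalFamily.sum_apply_eq hL.induced_symm he he' hn
    ((LinearMap.lsmul ℝ F : ℝ →ₗ[ℝ] F →ₗ[ℝ] F) ∘ₗ ((G ζ).comp A : F →ₗ[ℝ] ℝ))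

lemma sum_sff_eq (hL : IsLagrangianPoint G J A γ h T R) (hn : finrank ℝ F = n)
    (he : IsOrthonormalFamily γ e) (he' : IsOrthonormalFamily γ e') :
    ∑ i, h (e i) (e i) = ∑ i, h (e' i) (e' i) :=
  IsOrthonormalFamily.sum_apply_eq hL.induced_symm he he' hn
    (LinearMap.mk₂ ℝ h hL.add_left hL.smul_left hL.add_right hL.smul_right)

lemma pointwiseLowerBound_eq (hL : IsLagrangianPoint G J A γ h T R) (hn : finrank ℝ F = n)
    (he : IsOrthonormalFamily γ e) (he' : IsOrthonormalFamily γ e') (a b c : ℝ) (ξ : E) (X : F) :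
    pointwiseLowerBound G J A γ h R a b c ξ e X = pointwiseLowerBound G J A γ h R a b c ξ e' X := by
  simp only [pointwiseLowerBound, hL.sum_tangential_eq hn he he', hL.sum_sff_eq hn he he',
    hL.scalar_eq_half_sum, hL.sum_scalar_eq hn he he']

/-- The vectors `A e_i` and `J A e_i` form an orthonormal basis of the ambient space. -/
lemma inner_eq_sum (hL : IsLagrangianPoint G J A γ h T R) (hn : finrank ℝ F = n)
    (he : IsOrthonormalFamily γ e) (v w : E) :
    G v w = ∑ i, G v (A (e i)) * G w (A (e i)) + ∑ i, G v (J (A (e i))) * G w (J (A (e i))) := by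
  have hJ := hL.hermitian
  have hb : IsOrthonormalFamily G (Sum.elim (fun i => A (e i)) fun i => J (A (e i))) := by
    rintro (i | i) (j | j)
    · simpa [hL.induced] using he i j
    · simp [hJ.apply_J, hL.totally_real]
    · simp [hL.totally_real]
    · simpa [hJ.hermitian, hL.induced] using he i j
  have hcard : Fintype.card (Fin n ⊕ Fin n) = finrank ℝ E := by
    rw [hL.finrank_eq, hn, Fintype.card_sum, Fintype.card_fin]; ring
  conv_lhs => rw [hb.eq_sum hcard w]
  simp only [Fintype.sum_sum_type, Sum.elim_inl, Sum.elim_inr, map_add, map_sum, map_smul,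
    smul_eq_mul, hJ.symm w, mul_comm]

lemma inner_sff (hL : IsLagrangianPoint G J A γ h T R) (hn : finrank ℝ F = n)
    (he : IsOrthonormalFamily γ e) (i j k l : Fin n) :
    G (h (e i) (e j)) (h (e k) (e l))
      = ∑ r, sffComponents G J A h e i j r * sffComponents G J A h e k l r := by
  rw [hL.inner_eq_sum hn he]
  simp [hL.normal, sffComponents]

lemma sffComponents_comm (hL : IsLagrangianPoint G J A γ h T R) (e : Fin n → F) (i j r : Fin n) :
    sffComponents G J A h e i j r = sffComponents G J A h e j i r := by
  rw [sffComponents, hL.symm, sffComponents]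

/-- Together with `sffComponents_comm`, the components form a symmetric cubic form. -/
lemma sffComponents_comm_right (hL : IsLagrangianPoint G J A γ h T R) (e : Fin n → F)
    (i j r : Fin n) : sffComponents G J A h e i j r = sffComponents G J A h e i r j := by
  have := hL.comm (e i) (e j) (e r)
  rw [sffComponents, sffComponents, hL.hermitian.apply_J, hL.hermitian.symm _ (J (A (e j)))]
  linarith

/-- A unit vector `ξ` satisfies `‖ξ^⊤‖² + ‖(Jξ)^⊤‖² = 1`, since `(Jξ)^⊤` has the same length as the
normal part of `ξ`. -/
lemma sum_sq_add_sq (hL : IsLagrangianPoint G J A γ h T R) (hn : finrank ℝ F = n)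
    (he : IsOrthonormalFamily γ e) {ξ : E} (hξ : G ξ ξ = 1) :
    ∑ i, G ξ (A (e i)) ^ 2 + ∑ i, G (J ξ) (A (e i)) ^ 2 = 1 := by
  rw [← hξ, hL.inner_eq_sum hn he ξ ξ]
  simp only [hL.hermitian.apply_J, sq, neg_mul_neg]

lemma induced_tangential (hL : IsLagrangianPoint G J A γ h T R)
    (he : IsOrthonormalFamily γ e) (x y : Fin n → ℝ) :
    γ (∑ i, x i • e i) (∑ i, y i • e i) = ∑ i, x i * y i := by
  rw [hL.induced_symm, map_sum]
  refine Finset.sum_congr rfl fun i _ => ?_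
  rw [map_smul, hL.induced_symm, he.sum_smul, smul_eq_mul]

lemma inner_mean (hL : IsLagrangianPoint G J A γ h T R) (hn : finrank ℝ F = n)
    (he : IsOrthonormalFamily γ e) :
    G (∑ i, h (e i) (e i)) (∑ i, h (e i) (e i))
      = ∑ r, (∑ i, sffComponents G J A h e i i r) ^ 2 := by
  rw [hL.inner_eq_sum hn he]
  simp [hL.normal, sffComponents, sq, map_sum]

/-- The sectional curvatures of the submanifold, from the Gauss equation. -/
lemma sectional_eq (hL : IsLagrangianPoint G J A γ h T R) (hn : finrank ℝ F = n)
    (he : IsOrthonormalFamily γ e) {a b c : ℝ} {ξ : E}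
    (hT : ∀ X Y Z U, T X Y Z U = a * modelPi G J X Y Z U + b * modelPhi G J ξ X Y Z U
      + c * modelPsi G J ξ X Y Z U) (i j : Fin n) :
    R (e i) (e j) (e j) (e i) = a / 4 * (1 - if j = i then 1 else 0)
      + b / 8 * ((G ξ (A (e i)) ^ 2 + G (J ξ) (A (e i)) ^ 2)
        + (G ξ (A (e j)) ^ 2 + G (J ξ) (A (e j)) ^ 2)
        - 2 * if j = i then G ξ (A (e i)) ^ 2 + G (J ξ) (A (e i)) ^ 2 else 0)
      + c * (G ξ (A (e i)) * G (J ξ) (A (e j)) - G ξ (A (e j)) * G (J ξ) (A (e i))) ^ 2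
      + ∑ r, (sffComponents G J A h e i i r * sffComponents G J A h e j j r
        - sffComponents G J A h e i j r ^ 2) := by
  have hδ : ∀ i j, G (A (e i)) (A (e j)) = if i = j then 1 else 0 := fun i j => by
    rw [← hL.induced, he i j]
  have h1 : G (h (e j) (e j)) (h (e i) (e i)) - G (h (e i) (e j)) (h (e j) (e i))
      = ∑ r, (sffComponents G J A h e i i r * sffComponents G J A h e j j r
        - sffComponents G J A h e i j r ^ 2) := by
    rw [hL.symm (e j) (e i), hL.inner_sff hn he, hL.inner_sff hn he, ← Finset.sum_sub_distrib]
    exact Finset.sum_congr rfl fun r _ => by ring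
  rw [← h1, hL.gauss, hT]
  simp only [modelPi, modelPhi, modelPsi, hL.totally_real, hδ, if_true]
  by_cases hij : i = j
  · subst hij
    simp only [if_true]
    ring
  · simp only [hij, Ne.symm hij, if_false]
    ring

/-- The two sides of the Ricci inequality in the direction of a frame vector differ by a quadratic
expression in the second fundamental form alone: the terms with the ambient curvature cancel. -/
lemma ricci_sub_lowerBound (hL : IsLagrangianPoint G J A γ h T R) (hn : finrank ℝ F = n)
    (hn0 : n ≠ 0) (he : IsOrthonormalFamily γ e) {a b c : ℝ} {ξ : E} (hξ : G ξ ξ = 1)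
    (hT : ∀ X Y Z U, T X Y Z U = a * modelPi G J X Y Z U + b * modelPhi G J ξ X Y Z U
      + c * modelPsi G J ξ X Y Z U) (k : Fin n) :
    ∑ i, R (e k) (e i) (e i) (e k) - pointwiseLowerBound G J A γ h R a b c ξ e (e k)
      = ricciDefect (sffComponents G J A h e) k := by
  have hsec := hL.sectional_eq hn he hT
  have hone := hL.sum_sq_add_sq hn he hξ
  have hsc := hL.scalar_eq_half_sum e
  have hmean := hL.inner_mean hn he
  set x : Fin n → ℝ := fun i => G ξ (A (e i)) with hx
  set y : Fin n → ℝ := fun i => G (J ξ) (A (e i)) with hy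
  set C := sffComponents G J A h e with hC
  have hx' : ∀ i, G ξ (A (e i)) = x i := fun i => rfl
  have hy' : ∀ i, G (J ξ) (A (e i)) = y i := fun i => rfl
  simp only [hx', hy'] at hsec hone
  have hPsi : ∀ i, ∑ j, (x i * y j - x j * y i) ^ 2
      = x i ^ 2 * ∑ j, y j ^ 2 - 2 * (x i * y i) * ∑ j, x j * y j + y i ^ 2 * ∑ j, x j ^ 2 := by
    intro i
    rw [Finset.mul_sum, Finset.mul_sum, Finset.mul_sum, ← Finset.sum_sub_distrib,
      ← Finset.sum_add_distrib]
    exact Finset.sum_congr rfl fun j _ => by ring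
  have hSff : ∀ i, ∑ j, ∑ r, (C i i r * C j j r - C i j r ^ 2)
      = ∑ r, (C i i r * ∑ j, C j j r - ∑ j, C i j r ^ 2) := by
    intro i
    rw [Finset.sum_comm]
    refine Finset.sum_congr rfl fun r _ => ?_
    rw [Finset.sum_sub_distrib, Finset.mul_sum]
  have hRic : ∀ i, ∑ j, R (e i) (e j) (e j) (e i) = a / 4 * (n - 1)
      + b / 8 * ((n - 2) * (x i ^ 2 + y i ^ 2) + 1)
      + c * (x i ^ 2 * ∑ j, y j ^ 2 - 2 * (x i * y i) * ∑ j, x j * y j + y i ^ 2 * ∑ j, x j ^ 2)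
      + ∑ r, (C i i r * ∑ j, C j j r - ∑ j, C i j r ^ 2) := by
    intro i
    rw [Finset.sum_congr rfl fun j _ => hsec i j]
    simp only [Finset.sum_add_distrib, ← Finset.mul_sum, Finset.sum_sub_distrib, hPsi,
      Finset.sum_ite_eq', Finset.mem_univ, if_true, Finset.sum_const, Finset.card_univ,
      Fintype.card_fin, nsmul_eq_mul]
    have hS := hSff i
    simp only [Finset.sum_sub_distrib] at hS
    linear_combination b / 8 * hone + hS
  have hScal : ∑ i, ∑ j, R (e i) (e j) (e j) (e i) = a / 4 * (n * (n - 1))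
      + b / 8 * (2 * n - 2)
      + 2 * c * ((∑ j, x j ^ 2) * (∑ j, y j ^ 2) - (∑ j, x j * y j) ^ 2)
      + ∑ r, ((∑ j, C j j r) ^ 2 - ∑ i, ∑ j, C i j r ^ 2) := by
    have h1 : ∑ i, ∑ r, (C i i r * ∑ j, C j j r - ∑ j, C i j r ^ 2)
        = ∑ r, ((∑ j, C j j r) ^ 2 - ∑ i, ∑ j, C i j r ^ 2) := by
      rw [Finset.sum_comm]
      refine Finset.sum_congr rfl fun r _ => ?_
      rw [Finset.sum_sub_distrib, ← Finset.sum_mul, sq]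
    rw [Finset.sum_congr rfl fun i _ => hRic i, Finset.sum_add_distrib, h1]
    simp only [Finset.sum_add_distrib, ← Finset.mul_sum, ← Finset.sum_mul, Finset.sum_sub_distrib,
      Finset.sum_const, Finset.card_univ, Fintype.card_fin, nsmul_eq_mul]
    rw [hone]
    ring
  have hn' : (n : ℝ) ≠ 0 := by exact_mod_cast hn0
  simp only [pointwiseLowerBound, hx', hy', map_sub, map_smul, sub_apply, smul_apply, smul_eq_mul,
    hL.induced_tangential he, hmean]
  rw [hRic k, hsc, hScal, ricciDefect, meanCoefficient]
  have hcomm : ∑ j, y j * x j = ∑ j, x j * y j := Finset.sum_congr rfl fun j _ => mul_comm _ _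
  have hxx : ∑ j, x j * x j = ∑ j, x j ^ 2 := Finset.sum_congr rfl fun j _ => (sq _).symm
  have hyy : ∑ j, y j * y j = ∑ j, y j ^ 2 := Finset.sum_congr rfl fun j _ => (sq _).symm
  rw [hcomm, hxx, hyy]
  have h5 : 3 * (n : ℝ) + 5 ≠ 0 := by positivity
  field_simp
  ring

/-- The pointwise Ricci inequality, with its case of equality. -/
lemma ricci_ge (hL : IsLagrangianPoint G J A γ h T R) (hn : finrank ℝ F = n)
    (hn3 : 3 ≤ n) (he : IsOrthonormalFamily γ e) {a b c : ℝ} {ξ : E} (hξ : G ξ ξ = 1)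
    (hT : ∀ X Y Z U, T X Y Z U = a * modelPi G J X Y Z U + b * modelPhi G J ξ X Y Z U
      + c * modelPsi G J ξ X Y Z U) :
    (∀ X, γ X X = 1 → pointwiseLowerBound G J A γ h R a b c ξ e X ≤ ∑ i, R X (e i) (e i) X) ∧
    ((∀ X, γ X X = 1 → ∑ i, R X (e i) (e i) X = pointwiseLowerBound G J A γ h R a b c ξ e X) ↔
      ∀ u v, h u v = 0) := by
  have hframe : ∀ X, γ X X = 1 → ∃ (e' : Fin n → F) (k : Fin n),
      ∑ i, R X (e i) (e i) X - pointwiseLowerBound G J A γ h R a b c ξ e X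
        = ricciDefect (sffComponents G J A h e') k := by
    intro X hX
    obtain ⟨e', he', hk⟩ := he.exists_apply_eq hL.induced_symm hn hX ⟨0, by omega⟩
    refine ⟨e', ⟨0, by omega⟩, ?_⟩
    rw [hL.sum_ricci_eq hn he he', hL.pointwiseLowerBound_eq hn he he', ← hk]
    exact hL.ricci_sub_lowerBound hn (by omega) he' hξ hT _
  refine ⟨fun X hX => ?_, fun heq u v => ?_, fun h0 X hX => ?_⟩
  · obtain ⟨e', k, hk⟩ := hframe X hX
    have := ricciDefect_nonneg hn3 (hL.sffComponents_comm e') (hL.sffComponents_comm_right e') k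
    linarith
  · have hc : ∀ i j r, sffComponents G J A h e i j r = 0 :=
      eq_zero_of_ricciDefect_eq_zero hn3 (hL.sffComponents_comm e) (hL.sffComponents_comm_right e)
        fun k => by
          rw [← hL.ricci_sub_lowerBound hn (by omega) he hξ hT k,
            heq (e k) (by rw [he k k, if_pos rfl]), sub_self]
    have hij : ∀ i j, h (e i) (e j) = 0 := by
      intro i j
      by_contra hne
      have hpos := hL.hermitian.pos _ hne
      rw [hL.inner_sff hn he] at hpos
      simp [hc] at hpos
    have hcard : Fintype.card (Fin n) = finrank ℝ F := by rw [hn, Fintype.card_fin]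
    have hB : ∀ u v, LinearMap.mk₂ ℝ h hL.add_left hL.smul_left hL.add_right hL.smul_right u v
        = h u v := fun u v => rfl
    rw [← hB, he.eq_sum hcard u, he.eq_sum hcard v]
    simp only [map_sum, map_smul, LinearMap.sum_apply, LinearMap.smul_apply, hB, hij, smul_zero,
      Finset.sum_const_zero]
  · obtain ⟨e', k, hk⟩ := hframe X hX
    have h1 : ricciDefect (sffComponents G J A h e') k = 0 := by
      simp [ricciDefect, sffComponents, h0]
    linarith

end IsLagrangianPoint

end LagrangianPoint

/-! ### The curvature of a Kähler QCH-manifold -/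

section Ambient

variable {E : Type*} [NormedAddCommGroup E] [NormedSpace ℝ E] [FiniteDimensional ℝ E]
  {M : Type*} [TopologicalSpace M] [ChartedSpace E M] [IsManifold 𝓘(ℝ, E) ∞ M]
  {g : ContMDiffRiemannianMetric 𝓘(ℝ, E) ∞ E (fun x : M => TangentSpace 𝓘(ℝ, E) x)}
  {J : ∀ x : M, TangentSpace 𝓘(ℝ, E) x →L[ℝ] TangentSpace 𝓘(ℝ, E) x}
  {D : ∀ x : M, Submodule ℝ (TangentSpace 𝓘(ℝ, E) x)}

lemma IsKahler.isHermitianPair (hJ : IsKahler g J) (p : M) :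
    IsHermitianPair (E := E) (g.inner p) (J p) where
  symm := g.symm p
  pos := g.pos p
  sq := hJ.sq p
  hermitian := hJ.hermitian p

/-- The condition `∇J = 0`, solved for the derivative of `J` in a chart. -/
lemma IsKahler.fderiv_endoInChart (hJ : IsKahler g J) (p : M) {y : E}
    (hy : y ∈ (extChartAt 𝓘(ℝ, E) p).target) (u v : E) :
    fderiv ℝ (endoInChart J p) y u v
      = endoInChart J p y (christoffelCLM (metricInChart g.inner p) y u v)
        - christoffelCLM (metricInChart g.inner p) y u (endoInChart J p y v) := by
  have hd : HasFDerivAt (endoInChart J p) (fderiv ℝ (endoInChart J p) y) y :=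
    (((hJ.smooth p).contDiffAt ((isOpen_extChartAt_target p).mem_nhds hy)).differentiableAt
      (by simp)).hasFDerivAt
  have h1 := (hd.clm_apply (hasFDerivAt_const v y)).fderiv
  have h2 := hJ.parallel p y hy u v
  rw [h1] at h2
  simp only [← christoffelCLM_apply] at h2
  simp at h2
  rw [← sub_eq_zero, ← h2]
  abel

lemma metricInChart_extChartAt
    (g : ContMDiffRiemannianMetric 𝓘(ℝ, E) ∞ E (fun x : M => TangentSpace 𝓘(ℝ, E) x)) (p : M) :
    metricInChart g.inner p (extChartAt 𝓘(ℝ, E) p p)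
      = (show E →L[ℝ] E →L[ℝ] ℝ from g.inner p) := by
  ext v w
  exact metricInChart_self g.inner p v w

lemma endoInChart_extChartAt
    (J : ∀ x : M, TangentSpace 𝓘(ℝ, E) x →L[ℝ] TangentSpace 𝓘(ℝ, E) x) (p : M) :
    endoInChart J p (extChartAt 𝓘(ℝ, E) p p) = (show E →L[ℝ] E from J p) := by
  ext v
  exact endoInChart_self J p v

lemma riemann_eq (g : ContMDiffRiemannianMetric 𝓘(ℝ, E) ∞ E (fun x : M => TangentSpace 𝓘(ℝ, E) x))
    (p : M) (u v w z : E) :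
    riemann g.inner p u v w z
      = metricInChart g.inner p (extChartAt 𝓘(ℝ, E) p p)
        (curvatureOperator (christoffelCLM (metricInChart g.inner p)) (extChartAt 𝓘(ℝ, E) p p)
          u v w) z :=
  (isMetricOn_metricInChart g p).coordCurvature_eq (isOpen_extChartAt_target p)
    (mem_extChartAt_target p) u v w z

/-- The curvature of a Kähler metric has the Kähler symmetries at each point. -/
lemma IsKahler.isKahlerTensor (hJ : IsKahler g J) (p : M) :
    IsKahlerTensor (E := E) (J p) (riemann g.inner p) := by
  have hm := isMetricOn_metricInChart g p
  have ho : IsOpen (extChartAt 𝓘(ℝ, E) p).target := isOpen_extChartAt_target p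
  have hp : extChartAt 𝓘(ℝ, E) p p ∈ (extChartAt 𝓘(ℝ, E) p).target := mem_extChartAt_target p
  refine ⟨?_, ?_, ?_, ?_, ?_, ?_⟩
  · intro x x' y z u
    simp only [riemann_eq, curvatureOperator, map_add, map_sub, add_apply, sub_apply]
    ring
  · intro r x y z u
    simp only [riemann_eq, curvatureOperator, map_add, map_sub, map_smul, add_apply, sub_apply,
      smul_apply, smul_eq_mul]
    ring
  · intro x y z u
    rw [riemann_eq, riemann_eq, curvatureOperator_swap, map_neg, neg_apply]
  · intro x y z u
    rw [riemann_eq, riemann_eq]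
    exact hm.curvatureOperator_skew ho hp x y z u
  · intro x y z u
    rw [riemann_eq, riemann_eq, riemann_eq, ← add_apply, ← map_add, ← add_apply, ← map_add,
      hm.bianchi ho hp, map_zero, zero_apply]
  · intro x y z u
    have hc := hm.curvatureOperator_comm ho (hJ.smooth p)
      (fun y hy => hJ.fderiv_endoInChart p hy) hp x y z
    rw [endoInChart_self, endoInChart_self] at hc
    rw [riemann_eq, riemann_eq]
    refine (congrArg (fun v : E => metricInChart g.inner p (extChartAt 𝓘(ℝ, E) p p) v (J p u))
      hc).trans ?_
    exact (metricInChart_self g.inner p _ _).trans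
      ((hJ.hermitian p _ _).trans (metricInChart_self g.inner p _ _).symm)

/-- On a Kähler QCH-manifold the curvature is `a π + b Φ + c Ψ`. The unit vector `v` of `D` used to
read off the coefficients exists because `dim M > 2`. -/
lemma exists_isCurvatureCoefficients (hJ : IsKahler g J) (hD : IsInvariantDistribution g J D)
    (hQCH : IsQCH g J D) (hdim : 2 < finrank ℝ E) :
    ∃ a b c : M → ℝ, IsCurvatureCoefficients g J D a b c := by
  obtain ⟨f, hf⟩ := hQCH
  have key : ∀ x : M, ∃ abc : ℝ × ℝ × ℝ, ∀ t, 0 ≤ t → t ≤ 1 →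
      f x (Real.arccos √t) = abc.1 + abc.2.1 * t + abc.2.2 * t ^ 2 := by
    intro x
    have hh := hJ.isHermitianPair x
    obtain ⟨s, -, hxs, ξ, -, hξ⟩ := hD.smooth x
    have hξx := hξ x hxs
    have : FiniteDimensional ℝ (TangentSpace 𝓘(ℝ, E) x) := inferInstanceAs (FiniteDimensional ℝ E)
    have hpos : 0 < finrank ℝ (D x) := by
      have := hD.codim x
      omega
    obtain ⟨⟨v, hv⟩, hv0⟩ := Module.finrank_pos_iff_exists_ne_zero.1 hpos
    have hv0' : v ≠ 0 := fun h => hv0 (Subtype.ext h)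
    have hvv : 0 < g.inner x v v := g.pos x v hv0'
    have hsq : √(g.inner x v v) ^ 2 = g.inner x v v := Real.sq_sqrt hvv.le
    have hs0 : 0 < √(g.inner x v v) := Real.sqrt_pos.2 hvv
    obtain ⟨a, b, c, habc⟩ := (hJ.isKahlerTensor x).exists_coefficients hh (ξ := ξ x)
      (u := (√(g.inner x v v))⁻¹ • v) hξx.1
      (by
        change g.inner x ((√(g.inner x v v))⁻¹ • v) ((√(g.inner x v v))⁻¹ • v) = 1
        simp only [map_smul, smul_apply, smul_eq_mul]
        field_simp
        exact hsq.symm)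
      (by
        change g.inner x (ξ x) ((√(g.inner x v v))⁻¹ • v) = 0
        rw [map_smul, hξx.2 v hv, smul_zero])
      (by
        have h1 : g.inner x (J x (ξ x)) v = 0 := by
          have := hh.apply_J (ξ x) v
          change g.inner x (ξ x) (J x v) = -g.inner x (J x (ξ x)) v at this
          rw [hξx.2 _ (hD.invariant x v hv)] at this
          linarith
        change g.inner x (J x (ξ x)) ((√(g.inner x v v))⁻¹ • v) = 0
        rw [map_smul, h1, smul_zero])
      (f x) (fun X hX => hf x (ξ x) X hξx hX)
    exact ⟨(a, b, c), habc⟩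
  choose abc habc using key
  refine ⟨fun x => (abc x).1, fun x => (abc x).2.1, fun x => (abc x).2.2, fun x ξ hξ X Y Z U => ?_⟩
  have hh := hJ.isHermitianPair x
  refine (hJ.isKahlerTensor x).eq_model hh (ξ := ξ) (fun X hX => ?_) X Y Z U
  rw [← habc x _ (by positivity) (hh.sq_add_sq_le hξ.1 hX)]
  exact hf x ξ X hξ hX

end Ambient

/-! ### The second fundamental form of a Lagrangian immersion -/

section Submanifold

variable {E : Type*} [NormedAddCommGroup E] [NormedSpace ℝ E] [FiniteDimensional ℝ E]
  {F : Type*} [NormedAddCommGroup F] [NormedSpace ℝ F] [FiniteDimensional ℝ F]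
  {M : Type*} [TopologicalSpace M] [ChartedSpace E M] [IsManifold 𝓘(ℝ, E) ∞ M]
  {N : Type*} [TopologicalSpace N] [ChartedSpace F N] [IsManifold 𝓘(ℝ, F) ∞ N]
  {g : ContMDiffRiemannianMetric 𝓘(ℝ, E) ∞ E (fun x : M => TangentSpace 𝓘(ℝ, E) x)}
  {J : ∀ x : M, TangentSpace 𝓘(ℝ, E) x →L[ℝ] TangentSpace 𝓘(ℝ, E) x} {ι : N → M}

lemma secondFundamentalForm_eq
    (g : ContMDiffRiemannianMetric 𝓘(ℝ, E) ∞ E (fun x : M => TangentSpace 𝓘(ℝ, E) x))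
    (hι : ContMDiff 𝓘(ℝ, F) 𝓘(ℝ, E) ∞ ι)
    (hinj : ∀ p : N, Function.Injective (mfderiv 𝓘(ℝ, F) 𝓘(ℝ, E) ι p)) (p : N) (u v : F) :
    secondFundamentalForm g ι p u v = coordSecondFundamentalForm (metricInChart g.inner (ι p))
      (metricInChart (inducedMetric g ι) p) (writtenInExtChartAt 𝓘(ℝ, F) 𝓘(ℝ, E) p ι)
      (extChartAt 𝓘(ℝ, F) p p) u v := by
  have him := isIsometricImmersionOn_writtenInExtChartAt g hι hinj p
  have hd := ((him.hasFDerivAt_fderiv (mem_immersionDomain ι p)).clm_apply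
    (hasFDerivAt_const v _)).fderiv
  have hd' : fderiv ℝ (fun x => fderiv ℝ (writtenInExtChartAt 𝓘(ℝ, F) 𝓘(ℝ, E) p ι) x v)
      (extChartAt 𝓘(ℝ, F) p p) u
      = fderiv ℝ (fderiv ℝ (writtenInExtChartAt 𝓘(ℝ, F) 𝓘(ℝ, E) p ι))
        (extChartAt 𝓘(ℝ, F) p p) u v := by
    rw [hd]; simp
  simp only [secondFundamentalForm, coordSecondFundamentalForm, pullbackConnection,
    christoffelCLM_apply, hd']
  rfl

/-- At each point, a Lagrangian immersion gives the linear algebra data of `IsLagrangianPoint`; all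
the differential geometry enters the theorem through this lemma. -/
lemma IsLagrangianImmersion.isLagrangianPoint (hJ : IsKahler g J)
    (hι : IsLagrangianImmersion (F := F) g J ι) (p : N) :
    IsLagrangianPoint (E := E) (F := F) (g.inner (ι p)) (J (ι p)) (mfderiv 𝓘(ℝ, F) 𝓘(ℝ, E) ι p)
      (inducedMetric g ι p) (secondFundamentalForm g ι p) (riemann g.inner (ι p))
      (riemann (inducedMetric g ι) p) := by
  have him := isIsometricImmersionOn_writtenInExtChartAt g hι.contMDiff hι.injective_mfderiv p
  have hp := mem_immersionDomain (E := E) (F := F) ι p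
  have hsff := secondFundamentalForm_eq g hι.contMDiff hι.injective_mfderiv p
  have hder := fderiv_writtenInExtChartAt_self hι.contMDiff p
  have hval := writtenInExtChartAt_self (E := E) (F := F) ι p
  refine ⟨hJ.isHermitianPair (ι p), fun u v => rfl, hι.finrank_eq, hι.lagrangian p, ?_, ?_, ?_, ?_,
    ?_, hJ.isKahlerTensor (ι p), ?_⟩
  · intro u u' v
    simp only [hsff, coordSecondFundamentalForm, pullbackConnection, map_add, add_apply]
    abel
  · intro r u v
    simp only [hsff, coordSecondFundamentalForm, pullbackConnection, map_smul, smul_apply,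
      smul_sub, smul_add]
  · intro u v
    rw [hsff, hsff]
    exact him.coordSecondFundamentalForm_symm hp u v
  · intro u v w
    have h1 := him.apply_coordSecondFundamentalForm hp u v w
    rw [← hsff, hval, metricInChart_extChartAt, hder] at h1
    exact h1
  · intro u v w
    have h1 := him.coordSecondFundamentalForm_comm (hJ.smooth (ι p))
      (fun y hy => hJ.fderiv_endoInChart (ι p) hy)
      (fun x hx => lagrangian_writtenInExtChartAt hι p hx) hp u v w
    rw [← hsff, ← hsff, hval, metricInChart_extChartAt, endoInChart_extChartAt, hder] at h1
    exact h1
  · intro u v w z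
    have h1 := him.gauss hp u v w z
    rw [← him.isMetricOn_source.coordCurvature_eq him.isOpen_source hp, ← hsff, ← hsff, ← hsff,
      ← hsff, hval, ← riemann_eq, metricInChart_extChartAt, hder] at h1
    exact h1

end Submanifold

end KahlerQCH

end

end

theorem theorem5p1 {n : ℕ} (hn : 3 ≤ n)
    {E : Type*} [NormedAddCommGroup E] [NormedSpace ℝ E] [FiniteDimensional ℝ E]
    {F : Type*} [NormedAddCommGroup F] [NormedSpace ℝ F] [FiniteDimensional ℝ F]
    (hF : Module.finrank ℝ F = n)
    {M : Type*} [TopologicalSpace M] [ChartedSpace E M] [IsManifold 𝓘(ℝ, E) ∞ M]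
    {N : Type*} [TopologicalSpace N] [ChartedSpace F N] [IsManifold 𝓘(ℝ, F) ∞ N]
    (g : Bundle.ContMDiffRiemannianMetric 𝓘(ℝ, E) ∞ E (fun x : M => TangentSpace 𝓘(ℝ, E) x))
    (J : ∀ x : M, TangentSpace 𝓘(ℝ, E) x →L[ℝ] TangentSpace 𝓘(ℝ, E) x)
    (hJ : KahlerQCH.IsKahler g J)
    (D : ∀ x : M, Submodule ℝ (TangentSpace 𝓘(ℝ, E) x))
    (hD : KahlerQCH.IsInvariantDistribution g J D)
    (hQCH : KahlerQCH.IsQCH g J D)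
    (ι : N → M) (hι : KahlerQCH.IsLagrangianImmersion (F := F) g J ι) :
    (∃ a b c : M → ℝ, KahlerQCH.IsCurvatureCoefficients g J D a b c) ∧
    ∀ a b c : M → ℝ, KahlerQCH.IsCurvatureCoefficients g J D a b c →
      ∀ (p : N) (ξ : TangentSpace 𝓘(ℝ, E) (ι p)), KahlerQCH.IsUnitNormal g D (ι p) ξ →
      ∀ e : Fin n → TangentSpace 𝓘(ℝ, F) p,
        KahlerQCH.IsOrthonormalFrame (KahlerQCH.inducedMetric g ι) p e →
        (∀ X : TangentSpace 𝓘(ℝ, F) p, KahlerQCH.inducedMetric g ι p X X = 1 →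
          KahlerQCH.ricci (KahlerQCH.inducedMetric g ι) p e X ≥
            KahlerQCH.ricciLowerBound g J ι (a (ι p)) (b (ι p)) (c (ι p)) p ξ e X) ∧
        ((∀ X : TangentSpace 𝓘(ℝ, F) p, KahlerQCH.inducedMetric g ι p X X = 1 →
          KahlerQCH.ricci (KahlerQCH.inducedMetric g ι) p e X =
            KahlerQCH.ricciLowerBound g J ι (a (ι p)) (b (ι p)) (c (ι p)) p ξ e X) ↔
          KahlerQCH.IsTotallyGeodesicAt (F := F) g ι p) := by
  refine ⟨KahlerQCH.exists_isCurvatureCoefficients hJ hD hQCH ?_, ?_⟩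
  · rw [hι.finrank_eq, hF]; omega
  intro a b c habc p ξ hξ e he
  have hL := hι.isLagrangianPoint hJ p
  have key := hL.ricci_ge hF hn (a := a (ι p)) (b := b (ι p)) (c := c (ι p)) (ξ := ξ) he hξ.1
    (habc (ι p) ξ hξ)
  exact key
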